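/- Let $\mathscr D=\{(r,s,t)\in\mathbb C^3:\ \Re(r+t)>1,\ \Re(s+t)>1,\ \Re(r+s+t)>2\}$ and, for $x>0$ and $(r,s,t)\in\mathscr D$, put $$\Theta(r,s,t,x)=\sum_{n=1}^\infty\sum_{m=1}^\infty\frac{1}{n^r m^s (n+mx)^t}.$$ Let $r$ be an integer with $r\le 0$, let $\ell\ge 0$ be an integer with $\ell\ge 1-r$, and let $x>0$. For every fixed $s\in\mathbb C$ the function $t\mapsto\Theta(r,s,t,x)$ (defined by the series for $(r,s,t)\in\mathscr D$) has a meromorphic continuation to $t\in\mathbb C$, again denoted by $\Theta(r,s,t,x)$; at a removable singularity it is given its limit value. Write $t_0=1-r-\ell$, let $\zeta$ be the Riemann zeta function, $\gamma$ Euler's constant and $H_n=\sum_{j=1}^n 1/j$. Then, as $t\to t_0$, for fixed $r,s,\ell,x$: 1. If $s\in\mathbb C\setminus\mathbb Z$, or $s\in\mathbb Z$ with $s>r+\ell$ and $s\neq\ell+1$, then $\Theta(r,s,t,x)$ is analytic at $t=t_0$ and $$\Theta(r,s,t,x)=(-1)^{r-1}\frac{(r+\ell-1)!}{\ell!}x^\ell(-r)!\,\zeta(s-\ell)+\sum_{k=0}^{r+\ell-1}\frac{(r+\ell-1)!\,\zeta(r-k)}{x^{1-r-\ell+k}\,k!\,(r+\ell-k-1)!}\zeta(-r+s-\ell+k+1)+O(|t-t_0|).$$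 2. If $s=\ell+1$, then $$\Theta(r,s,t,x)=(-1)^{r-1}(-r)!\,x^\ell\frac{(r+\ell-1)!}{\ell!\,(t-t_0)}+(-1)^{r-1}(-r)!\,x^\ell\frac{(r+\ell-1)!}{\ell!}\left(\gamma-\log x+H_\ell-H_{r+\ell-1}\right)+\sum_{k=0}^{r+\ell-1}\binom{r+\ell-1}{k}\frac{\zeta(r-k)}{x^{k-r-\ell+1}}\zeta(k-r+2)+O(|t-t_0|).$$ 3. If $s\in\mathbb Z$, $s\le 0$ and $s\le r+\ell$, then $\Theta(r,s,t,x)$ is analytic at $t=t_0$ and $$\Theta(r,s,t,x)=(-1)^{r-1}x^\ell\frac{(-r)!\,(r+\ell-1)!}{\ell!}\zeta(s-\ell)+\sum_{k=0}^{r+\ell-1}\frac{\zeta(r-k)\,(r+\ell-1)!}{x^{k-r-\ell+1}\,k!\,(r+\ell-k-1)!}\zeta(s+1-r-\ell+k)+(-1)^{s-1}x^{s-1}\frac{(r+\ell-1)!\,(-s)!}{(r+\ell-s)!}\zeta(s-\ell)+O(|t-t_0|).$$ 4. If $s\in\mathbb Z$ and $1\le s\le r+\ell$, then $$\Theta(r,s,t,x)=x^{s-1}\frac{(r+\ell-1)!}{(r+\ell-s)!\,(s-1)!}\,\frac{\zeta(s-\ell)}{t-t_0}+x^{s-1}\frac{(r+\ell-1)!}{(r+\ell-s)!\,(s-1)!}\left(\gamma-H_{r+\ell-1}+H_{s-1}-\log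 x\right)\zeta(s-\ell)-(-1)^r x^\ell\frac{(-r)!\,(r+\ell-1)!}{\ell!}\zeta(s-\ell)+\sum_{\substack{k=0\\ k\ne r+\ell-s}}^{r+\ell-1}\frac{(r+\ell-1)!\,\zeta(r-k)}{(r+\ell-k-1)!\,x^{k-r-\ell+1}\,k!}\zeta(s-r-\ell+k+1)+O(|t-t_0|).$$ -/

import Mathlib

open Set Filter Topology Asymptotics

noncomputable section

namespace MordellTornheim

/-- The region of `(r, s, t)` in which the defining double series converges absolutely. -/
def region : Set (ℂ × ℂ × ℂ) :=
  {p | 1 < (p.1 + p.2.2).re ∧ 1 < (p.2.1 + p.2.2).re ∧ 2 < (p.1 + p.2.1 + p.2.2).re}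

/-- The double series `∑_{n, m ≥ 1} 1 / (n ^ r * m ^ s * (n + m x) ^ t)`. -/
def thetaSeries (r s t : ℂ) (x : ℝ) : ℂ :=
  ∑' p : ℕ+ × ℕ+,
    1 / ((p.1 : ℂ) ^ r * (p.2 : ℂ) ^ s * ((p.1 : ℂ) + (p.2 : ℂ) * (x : ℂ)) ^ t)

/-- `F` is the meromorphic continuation, in the variable `t` (with `r`, `s`, `x` fixed), of the
double series. The normal form fixes the values of `F` on its exceptional set: `F` is
continuous at each removable singularity, and takes the value `0` at its poles. -/
structure IsContinuation (r s : ℂ) (x : ℝ) (F : ℂ → ℂ) : Prop where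
  meromorphic : MeromorphicNFOn F univ
  eq_series : ∀ t : ℂ, (r, s, t) ∈ region → F t = thetaSeries r s t x

open Classical in
/-- The continued function `Θ(r, s, t, x)`, as a meromorphic function of `t`. -/
def Theta (r s t : ℂ) (x : ℝ) : ℂ :=
  if h : ∃ F : ℂ → ℂ, IsContinuation r s x F then h.choose t else 0

/-- The continuation is unique, so that `Theta` does not depend on a choice. -/
theorem IsContinuation.unique {r s : ℂ} {x : ℝ} {F G : ℂ → ℂ}
    (hF : IsContinuation r s x F) (hG : IsContinuation r s x G) : F = G := by
  have hM : MeromorphicOn (F - G) univ := hF.meromorphic.meromorphicOn.sub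
    hG.meromorphic.meromorphicOn
  set c : ℝ := 2 + |r.re| + |s.re| with hc
  have hopen : IsOpen {t : ℂ | c < t.re} := isOpen_lt continuous_const Complex.continuous_re
  have hmem : (((c + 1 : ℝ)) : ℂ) ∈ {t : ℂ | c < t.re} := by simp
  have htop : meromorphicOrderAt (F - G) ((c + 1 : ℝ) : ℂ) = ⊤ := by
    rw [meromorphicOrderAt_eq_top_iff]
    refine (Filter.Eventually.filter_mono nhdsWithin_le_nhds ?_)
    filter_upwards [hopen.mem_nhds hmem] with t ht
    have hreg : (r, s, t) ∈ region := by
      have h1 := neg_abs_le r.re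
      have h2 := neg_abs_le s.re
      have h3 := abs_nonneg r.re
      have h4 := abs_nonneg s.re
      replace ht : c < t.re := ht
      change 1 < (r + t).re ∧ 1 < (s + t).re ∧ 2 < (r + s + t).re
      simp only [Complex.add_re]
      refine ⟨?_, ?_, ?_⟩ <;> linarith
    simp [hF.eq_series t hreg, hG.eq_series t hreg]
  have hall : ∀ z : ℂ, meromorphicOrderAt (F - G) z = ⊤ := by
    intro z
    by_contra hz
    exact hM.meromorphicOrderAt_ne_top_of_isPreconnected isPreconnected_univ (mem_univ z)
      (mem_univ _) hz htop
  funext z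
  have h := meromorphicOrderAt_eq_top_iff.1 (hall z)
  have h' : F =ᶠ[𝓝[≠] z] G := by
    filter_upwards [h] with t ht
    exact sub_eq_zero.1 ht
  exact (((hF.meromorphic (mem_univ z)).eventuallyEq_nhdsNE_iff_eventuallyEq_nhds
    (hG.meromorphic (mem_univ z))).1 h').eq_of_nhds

/-- The factorial of a (non-negative) integer, as a complex number. -/
def fac (n : ℤ) : ℂ := (n.toNat.factorial : ℂ)

/-- The harmonic number `H_n = ∑_{j = 1}^n 1 / j` of a (non-negative) integer, as a complex
number. -/
def H (n : ℤ) : ℂ := ((harmonic n.toNat : ℚ) : ℂ)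

end MordellTornheim

end

/-! Write `r = -a`, `ℓ = N + a + 1`, so that `t₀ = -N`. For `a = 0`, Euler-Maclaurin summation over
`n` of `(n + mx)^(-t)`, followed by summation over `m`, gives an explicit finite combination of zeta
values plus a remainder that is holomorphic on a half-plane as far left as desired
(`hasSum_seriesTerm_zero`). Writing `n = (n + mx) - mx` raises `a` by one, and the explicit part
obeys the same recursion (`seriesTerm_succ`, `mainPart_succ`). Hence `exists_expansion`: the double
series is `a!/((t-1)⋯(t-a-1)) x^(a+1-t) ζ(s+t-a-1) + ∑_{k<K} C(-t,k) ζ(-a-k) x^(-t-k) ζ(s+t+k) +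
E(t)`. This yields the continuation, by gluing over half-planes. Moreover `E(-N) = 0` for `N < K`,
because `C(N,k) = 0` for `k > N`, so the explicit part alone determines the residue and constant
term at `-N`.

The cases record which zeta factor meets its pole at `t = -N`. The leading one does iff `s = ℓ + 1`;
the `k`-th one does iff `k = N + 1 - s`. If that `k` is at most `N`, the pole survives, and
differentiating the coefficient produces harmonic numbers and `log x`. If `k > N`, that is `s ≤ 0`,
the simple zero of `C(-t,k)` cancels the pole and leaves one extra constant. All of this follows
from the Laurent rule `LaurentAt.mul_riemannZeta`. -/

namespace MordellTornheim

/-! ### Generalized binomial coefficients -/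

/-- The generalized binomial coefficient `(-t choose k)`. -/
noncomputable def negBinom (t : ℂ) (k : ℕ) : ℂ :=
  (∏ j ∈ Finset.range k, (-t - j)) / (k.factorial : ℂ)

theorem negBinom_zero (t : ℂ) : negBinom t 0 = 1 := by simp [negBinom]

theorem negBinom_succ_right (t : ℂ) (k : ℕ) :
    negBinom t (k + 1) = negBinom t k * (-t - k) / (k + 1) := by
  have h1 : (k.factorial : ℂ) ≠ 0 := by exact_mod_cast k.factorial_ne_zero
  have h2 : ((k : ℂ) + 1) ≠ 0 := by exact_mod_cast k.succ_ne_zero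
  rw [negBinom, negBinom, Finset.prod_range_succ, Nat.factorial_succ]
  push_cast
  field_simp

/-- Pascal's rule with upper index `1 - t`; it drives the induction on `a` in `mainPart_succ`. -/
theorem negBinom_pascal (t : ℂ) (k : ℕ) :
    negBinom (t - 1) (k + 1) - negBinom t (k + 1) = negBinom t k := by
  have h1 : (k.factorial : ℂ) ≠ 0 := by exact_mod_cast k.factorial_ne_zero
  have h2 : ((k : ℂ) + 1) ≠ 0 := by exact_mod_cast k.succ_ne_zero
  have h3 : ∏ j ∈ Finset.range (k + 1), (-(t - 1) - (j : ℂ))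
      = (∏ j ∈ Finset.range k, (-t - (j : ℂ))) * (1 - t) := by
    rw [Finset.prod_range_succ']
    congr 1
    · refine Finset.prod_congr rfl fun j _ => ?_
      push_cast; ring
    · simp
  rw [negBinom, negBinom, negBinom, h3, Finset.prod_range_succ, Nat.factorial_succ]
  push_cast
  field_simp
  ring

theorem negBinom_neg_eq_zero {N k : ℕ} (h : N < k) : negBinom (-(N : ℂ)) k = 0 := by
  rw [negBinom, Finset.prod_eq_zero (Finset.mem_range.2 h) (by simp), zero_div]

theorem differentiable_negBinom (k : ℕ) : Differentiable ℂ fun t => negBinom t k := by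
  unfold negBinom
  fun_prop

/-! ### Euler-Maclaurin on a unit interval -/

/-- The remainder integral of the Euler-Maclaurin formula for `u ↦ (v + u) ^ (-t)`. -/
noncomputable def remInt (K : ℕ) (t : ℂ) (v : ℝ) : ℂ :=
  ∫ u in (0 : ℝ)..1, (bernoulliFun K u : ℂ) * ((v + u : ℝ) : ℂ) ^ (-t - K)

theorem hasDerivAt_add_cpow {v u : ℝ} (h : 0 < v + u) (z : ℂ) :
    HasDerivAt (fun u : ℝ => ((v + u : ℝ) : ℂ) ^ z) (z * ((v + u : ℝ) : ℂ) ^ (z - 1)) u := by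
  have h1 : HasDerivAt (fun w : ℂ => w ^ z) (z * ((v + u : ℝ) : ℂ) ^ (z - 1))
      ((v + u : ℝ) : ℂ) := by
    have := (hasDerivAt_id ((v + u : ℝ) : ℂ)).cpow_const (c := z) (Or.inl (by simpa using h))
    simpa using this
  have h2 : HasDerivAt (fun u : ℝ => ((v + u : ℝ) : ℂ)) 1 u :=
    ((hasDerivAt_id u).const_add v).ofReal_comp
  have h3 := HasDerivAt.comp (𝕜 := ℝ) (𝕜' := ℂ) u h1 h2
  exact h3.congr_deriv (mul_one _)

theorem continuousOn_add_cpow {v : ℝ} (hv : 0 < v) (z : ℂ) :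
    ContinuousOn (fun u : ℝ => ((v + u : ℝ) : ℂ) ^ z) (uIcc 0 1) := fun u hu => by
  rw [uIcc_of_le zero_le_one] at hu
  exact (hasDerivAt_add_cpow (by linarith [hu.1]) z).continuousAt.continuousWithinAt

theorem continuous_bernoulliFun_ofReal (K : ℕ) :
    Continuous fun u : ℝ => (bernoulliFun K u : ℂ) :=
  Complex.continuous_ofReal.comp (continuous_bernoulliFun K)

/-- Integration by parts, with `B_{K+1}/(K+1)` as primitive of `B_K`. The factor `negBinom t K`
absorbs the `-t - K` coming from the derivative of the power, turning it into `negBinom t (K + 1)`.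
-/
theorem remInt_succ {v : ℝ} (hv : 0 < v) (t : ℂ) (K : ℕ) :
    negBinom t K * remInt K t v =
      negBinom t K / (K + 1) * (bernoulliFun (K + 1) 1 * ((v + 1 : ℝ) : ℂ) ^ (-t - K)
        - bernoulliFun (K + 1) 0 * (v : ℂ) ^ (-t - K))
      - negBinom t (K + 1) * remInt (K + 1) t v := by
  have h2 : ((K : ℂ) + 1) ≠ 0 := by exact_mod_cast K.succ_ne_zero
  have key := intervalIntegral.integral_mul_deriv_eq_deriv_mul (a := (0 : ℝ)) (b := 1)
    (u := fun u : ℝ => ((v + u : ℝ) : ℂ) ^ (-t - K))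
    (u' := fun u : ℝ => (-t - K) * ((v + u : ℝ) : ℂ) ^ (-t - K - 1))
    (v := fun u : ℝ => (bernoulliFun (K + 1) u : ℂ) / (K + 1))
    (v' := fun u : ℝ => (bernoulliFun K u : ℂ))
    (fun u hu => by
      rw [uIcc_of_le zero_le_one] at hu
      exact hasDerivAt_add_cpow (by linarith [hu.1]) _)
    (fun u _ => by
      refine ((hasDerivAt_bernoulliFun (K + 1) u).ofReal_comp.div_const
        ((K : ℂ) + 1)).congr_deriv ?_
      rw [Nat.add_sub_cancel]
      push_cast
      field_simp)
    ((continuousOn_const.mul (continuousOn_add_cpow hv _)).intervalIntegrable)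
    ((continuous_bernoulliFun_ofReal K).intervalIntegrable _ _)
  have e1 : remInt K t v = ∫ u in (0 : ℝ)..1, ((v + u : ℝ) : ℂ) ^ (-t - K) *
      (bernoulliFun K u : ℂ) := by
    simp only [remInt, mul_comm]
  have e2 : ∫ u in (0 : ℝ)..1, (-t - K) * ((v + u : ℝ) : ℂ) ^ (-t - K - 1) *
      ((bernoulliFun (K + 1) u : ℂ) / (K + 1)) = (-t - K) / (K + 1) * remInt (K + 1) t v := by
    rw [remInt, ← intervalIntegral.integral_const_mul]
    congr 1
    funext u
    have : -t - K - 1 = -t - ((K + 1 : ℕ) : ℂ) := by push_cast; ring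
    rw [this]
    ring
  rw [e1, key, e2, negBinom_succ_right]
  simp only [add_zero]
  ring

/-- Each integration by parts adds one term, since `ζ(-k) = (-1)^k B_{k+1}/(k+1)`. The isolated `(v
+ 1)^(-t)` reflects `B_1(1) = 1/2 = B_1(0) + 1`; all later Bernoulli polynomials agree at the two
endpoints. -/
theorem euler_maclaurin_unit {v : ℝ} (hv : 0 < v) {t : ℂ} (ht : t ≠ 1) (K : ℕ) :
    ((v + 1 : ℝ) : ℂ) ^ (-t) + (((v + 1 : ℝ) : ℂ) ^ (1 - t) - (v : ℂ) ^ (1 - t)) / (t - 1)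
      + ∑ k ∈ Finset.range (K + 1), negBinom t k * riemannZeta (-k) *
        (((v + 1 : ℝ) : ℂ) ^ (-t - k) - (v : ℂ) ^ (-t - k))
      = (-1) ^ K * (negBinom t (K + 1) * remInt (K + 1) t v) := by
  induction K with
  | zero =>
    have h1 := remInt_succ hv t 0
    -- `B_0 = 1`, so the zeroth remainder is the plain integral of the power; `t ≠ 1` is what makes
    -- it elementary.
    have h3 : remInt 0 t v = -((((v + 1 : ℝ) : ℂ) ^ (1 - t) - (v : ℂ) ^ (1 - t)) / (t - 1)) := by
      have ht' : 1 - t ≠ 0 := sub_ne_zero.2 ht.symm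
      have ht2 : t - 1 ≠ 0 := sub_ne_zero.2 ht
      have := intervalIntegral.integral_eq_sub_of_hasDerivAt (a := (0 : ℝ)) (b := 1)
        (f := fun u : ℝ => ((v + u : ℝ) : ℂ) ^ (1 - t) / (1 - t))
        (f' := fun u : ℝ => ((v + u : ℝ) : ℂ) ^ (-t))
        (fun u hu => by
          rw [uIcc_of_le zero_le_one] at hu
          refine ((hasDerivAt_add_cpow (v := v) (u := u) (by linarith [hu.1]) (1 - t)).div_const
            (1 - t)).congr_deriv ?_
          rw [mul_div_cancel_left₀ _ ht']
          congr 1; ring)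
        (continuousOn_add_cpow hv _).intervalIntegrable
      simp only [remInt, bernoulliFun_zero, Nat.cast_zero, sub_zero, Complex.ofReal_one, one_mul]
      rw [this]
      simp only [add_zero]
      field_simp
      ring
    rw [h3] at h1
    rw [pow_zero, one_mul]
    simp only [negBinom_zero, Nat.cast_zero] at h1
    simp only [zero_add, Finset.sum_range_one, negBinom_zero, Nat.cast_zero, neg_zero,
      riemannZeta_zero]
    push_cast at h1 ⊢
    simp only [zero_add, bernoulliFun_one] at h1
    push_cast at h1 ⊢
    simp only [sub_zero] at h1 ⊢
    linear_combination -h1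
  | succ K ih =>
    rw [Finset.sum_range_succ, ← add_assoc, ih, remInt_succ hv t (K + 1),
      bernoulliFun_endpoints_eq_of_ne_one (k := K + 1 + 1) (by omega),
      riemannZeta_neg_nat_eq_bernoulli, bernoulliFun_eval_zero]
    push_cast
    ring

theorem exists_norm_remInt_le (K : ℕ) : ∃ C : ℝ, 0 ≤ C ∧ ∀ (t : ℂ) (v : ℝ), 0 < v →
    0 ≤ t.re + K → ‖remInt K t v‖ ≤ C * v ^ (-(t.re + K)) := by
  obtain ⟨C, hC⟩ := (isCompact_Icc (a := (0 : ℝ)) (b := 1)).exists_bound_of_continuousOn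
    (continuous_bernoulliFun K).continuousOn
  refine ⟨C, (norm_nonneg _).trans (hC 0 (by simp)), fun t v hv ht => ?_⟩
  have := intervalIntegral.norm_integral_le_of_norm_le_const (a := (0 : ℝ)) (b := 1)
    (f := fun u => (bernoulliFun K u : ℂ) * ((v + u : ℝ) : ℂ) ^ (-t - K))
    (C := C * v ^ (-(t.re + K))) (fun u hu => by
      rw [uIoc_of_le zero_le_one] at hu
      rw [norm_mul, Complex.norm_real, Complex.norm_cpow_eq_rpow_re_of_pos (by linarith [hu.1])]
      have h1 : (-t - (K : ℂ)).re = -(t.re + K) := by simp; ring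
      rw [h1]
      refine mul_le_mul (hC u ⟨hu.1.le, hu.2⟩) ?_
        (Real.rpow_nonneg (by linarith [hu.1]) _)
        ((norm_nonneg _).trans (hC 0 (by simp)))
      exact Real.rpow_le_rpow_of_nonpos hv (by linarith [hu.1]) (by linarith))
  simpa [remInt] using this

/-- Differentiation under the integral sign; the `t`-derivative of the integrand is continuous on a
compact set (closed ball times `[0, 1]`), hence dominated by a constant. -/
theorem differentiable_remInt (K : ℕ) {v : ℝ} (hv : 0 < v) :
    Differentiable ℂ fun t => remInt K t v := by
  intro t₀
  set F' : ℂ → ℝ → ℂ := fun t u => (bernoulliFun K u : ℂ) *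
    (((v + u : ℝ) : ℂ) ^ (-t - K) * Complex.log ((v + u : ℝ) : ℂ) * (-1)) with hF'
  have hslit : ∀ u ∈ uIcc (0 : ℝ) 1, ((v + u : ℝ) : ℂ) ∈ Complex.slitPlane := fun u hu => by
    rw [uIcc_of_le zero_le_one] at hu
    exact Complex.ofReal_mem_slitPlane.2 (by linarith [hu.1])
  have hcont : ContinuousOn (fun p : ℂ × ℝ => F' p.1 p.2)
      (Metric.closedBall t₀ 1 ×ˢ uIcc (0 : ℝ) 1) := by
    have h1 : ContinuousOn (fun p : ℂ × ℝ => ((v + p.2 : ℝ) : ℂ))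
      (Metric.closedBall t₀ 1 ×ˢ uIcc (0 : ℝ) 1) := by fun_prop
    have h2 : ContinuousOn (fun p : ℂ × ℝ => (bernoulliFun K p.2 : ℂ))
      (Metric.closedBall t₀ 1 ×ˢ uIcc (0 : ℝ) 1) :=
      ((continuous_bernoulliFun_ofReal K).comp continuous_snd).continuousOn
    have h3 : ContinuousOn (fun p : ℂ × ℝ => -p.1 - (K : ℂ))
      (Metric.closedBall t₀ 1 ×ˢ uIcc (0 : ℝ) 1) := by fun_prop
    exact h2.mul (((h1.cpow h3 fun p hp => hslit _ hp.2).mul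
      (h1.clog fun p hp => hslit _ hp.2)).mul continuousOn_const)
  obtain ⟨C, hC⟩ := ((isCompact_closedBall t₀ 1).prod
    (isCompact_uIcc (a := (0 : ℝ)) (b := 1))).exists_bound_of_continuousOn hcont
  have hcF : ∀ t : ℂ, ContinuousOn (fun u : ℝ => (bernoulliFun K u : ℂ) * ((v + u : ℝ) : ℂ) ^ (-t - K))
      (uIcc 0 1) := fun t =>
    (continuous_bernoulliFun_ofReal K).continuousOn.mul (continuousOn_add_cpow hv _)
  have hcF' : ContinuousOn (F' t₀) (uIcc 0 1) :=
    hcont.comp (f := fun u : ℝ => (t₀, u)) (by fun_prop) fun u hu => ⟨by simp, hu⟩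
  refine (intervalIntegral.hasDerivAt_integral_of_dominated_loc_of_deriv_le
    (F := fun (t : ℂ) (u : ℝ) => (bernoulliFun K u : ℂ) * ((v + u : ℝ) : ℂ) ^ (-t - K))
    (F' := F') (s := Metric.closedBall t₀ 1) (bound := fun _ => C)
    (Metric.closedBall_mem_nhds t₀ one_pos)
    (Eventually.of_forall fun t => (hcF t).intervalIntegrable.def'.aestronglyMeasurable)
    (hcF t₀).intervalIntegrable hcF'.intervalIntegrable.def'.aestronglyMeasurable
    (Eventually.of_forall fun u hu t ht => hC (t, u) ⟨ht, uIoc_subset_uIcc hu⟩)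
    intervalIntegrable_const
    (Eventually.of_forall fun u hu t _ => ?_)).2.differentiableAt
  have hne := Complex.slitPlane_ne_zero (hslit u (uIoc_subset_uIcc hu))
  have h : HasDerivAt (fun t : ℂ => -t - (K : ℂ)) (-1) t :=
    (hasDerivAt_id t).fun_neg.sub_const (K : ℂ)
  exact (h.const_cpow (Or.inl hne)).const_mul _

/-! ### Convergence of the lattice sums -/

theorem summable_pnat_rpow {b : ℝ} (hb : 1 < b) : Summable fun n : ℕ+ => (n : ℝ) ^ (-b) :=
  (Real.summable_nat_rpow.2 (by linarith : -b < -1)).comp_injective PNat.coe_injective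

/-- Weighted AM-GM, `n^θ (mx)^(1-θ) ≤ n + mx` with `θ = b/τ`, bounds the double sum by a product of
two convergent single sums. -/
theorem summable_pnat_rpow_mul_add_rpow {σ τ x : ℝ} (hx : 0 < x) (hτ : 1 < τ) (hστ : 2 < σ + τ) :
    Summable fun p : ℕ+ × ℕ+ => (p.2 : ℝ) ^ (-σ) * ((p.1 : ℝ) + p.2 * x) ^ (-τ) := by
  -- The exponents of `n` and `m` become `b` and `σ + τ - b`; both must exceed `1`, and `b < τ`
  -- keeps the weights in `[0, 1]`.
  obtain ⟨b, hb1, hb2⟩ : ∃ b, 1 < b ∧ b < min τ (σ + τ - 1) :=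
    exists_between (lt_min hτ (by linarith))
  obtain ⟨hbτ, hbσ⟩ := lt_min_iff.1 hb2
  have h1 := summable_pnat_rpow hb1
  have h2 := (summable_pnat_rpow (b := σ + τ - b) (by linarith)).mul_left (x ^ (-(τ - b)))
  have h3 := h1.mul_of_nonneg h2 (fun _ => by positivity) (fun _ => by positivity)
  refine Summable.of_nonneg_of_le (fun _ => by positivity) (fun p => ?_) h3
  obtain ⟨n, m⟩ := p
  have hn : (0 : ℝ) < n := by exact_mod_cast n.pos
  have hm : (0 : ℝ) < m := by exact_mod_cast m.pos
  have hτ0 : 0 < τ := by linarith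
  have hθ0 : 0 ≤ b / τ := by positivity
  have hθ1 : 0 ≤ 1 - b / τ := sub_nonneg.2 ((div_le_one hτ0).2 hbτ.le)
  have hmx : 0 < (m : ℝ) * x := by positivity
  have amgm := Real.geom_mean_le_arith_mean2_weighted hθ0 hθ1 hn.le hmx.le (by ring)
  have hle : (n : ℝ) ^ (b / τ) * (m * x) ^ (1 - b / τ) ≤ n + m * x := by
    refine amgm.trans (add_le_add ?_ ?_)
    · exact mul_le_of_le_one_left hn.le (by linarith)
    · exact mul_le_of_le_one_left hmx.le (by linarith)
  have hpow := Real.rpow_le_rpow_of_nonpos (by positivity) hle (by linarith : -τ ≤ 0)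
  have e1 : ((n : ℝ) ^ (b / τ) * (m * x) ^ (1 - b / τ)) ^ (-τ)
      = (n : ℝ) ^ (-b) * (x ^ (-(τ - b)) * (m : ℝ) ^ (-(τ - b))) := by
    rw [Real.mul_rpow (by positivity) (by positivity), ← Real.rpow_mul hn.le,
      ← Real.rpow_mul hmx.le, Real.mul_rpow hm.le hx.le]
    have e2 : b / τ * -τ = -b := by field_simp
    have e3 : (1 - b / τ) * -τ = -(τ - b) := by field_simp
    rw [e2, e3]; ring
  have e4 : (m : ℝ) ^ (-(σ + τ - b)) = (m : ℝ) ^ (-σ) * (m : ℝ) ^ (-(τ - b)) := by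
    rw [← Real.rpow_add hm]; ring_nf
  calc (m : ℝ) ^ (-σ) * ((n : ℝ) + m * x) ^ (-τ)
      ≤ (m : ℝ) ^ (-σ) * ((n : ℝ) ^ (-b) * (x ^ (-(τ - b)) * (m : ℝ) ^ (-(τ - b)))) := by
        rw [← e1]; gcongr
    _ = (n : ℝ) ^ (-b) * (x ^ (-(τ - b)) * (m : ℝ) ^ (-(σ + τ - b))) := by rw [e4]; ring

theorem pnat_shift_pos (p : ℕ+ × ℕ+) {x : ℝ} (hx : 0 < x) :
    0 < (p.1 : ℝ) - 1 + p.2 * x := by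
  have hn : (1 : ℝ) ≤ p.1 := Nat.one_le_cast.2 p.1.pos
  have hm : (0 : ℝ) < p.2 := by exact_mod_cast p.2.pos
  have : 0 < (p.2 : ℝ) * x := by positivity
  linarith

/-- Makes the bound uniform on a vertical strip. Since `v = n - 1 + mx ≥ x`, the base `v / x` is at
least `1` and its power is controlled by the left edge `L`. The leftover power of `x` lies between
its values at the two edges, whence the sum in the constant. -/
theorem exists_norm_remInt_lattice_le (K : ℕ) {x L M : ℝ} (hx : 0 < x) (hL : 0 ≤ L + K) :
    ∃ C : ℝ, ∀ (p : ℕ+ × ℕ+) (t : ℂ), L ≤ t.re → t.re ≤ M →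
      ‖remInt K t (p.1 - 1 + p.2 * x)‖ ≤ C * ((p.1 : ℝ) + p.2 * x) ^ (-(L + K)) := by
  obtain ⟨C, hC0, hC⟩ := exists_norm_remInt_le K
  refine ⟨C * ((x ^ (-(L + K)) + x ^ (-(M + K))) * (1 / (1 + x)) ^ (-(L + K))),
    fun p t hLt htM => ?_⟩
  obtain ⟨n, m⟩ := p
  have hn : (1 : ℝ) ≤ n := Nat.one_le_cast.2 n.pos
  have hm : (1 : ℝ) ≤ m := Nat.one_le_cast.2 m.pos
  set v : ℝ := (n : ℝ) - 1 + m * x with hv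
  have hvx : x ≤ v := by nlinarith
  have hv0 : 0 < v := by linarith
  have h1 : 1 ≤ v / x := (one_le_div hx).2 hvx
  have h2 : 1 / (1 + x) * (n + m * x) ≤ v / x := by
    rw [one_div_mul_eq_div, div_le_div_iff₀ (by positivity) hx]
    nlinarith [mul_nonneg (sub_nonneg.2 hm) hx.le]
  have h3 : x ^ (-(t.re + K)) ≤ x ^ (-(L + K)) + x ^ (-(M + K)) := by
    rcases le_total 1 x with h | h
    · exact (Real.rpow_le_rpow_of_exponent_le h (by linarith)).trans
        (le_add_of_nonneg_right (by positivity))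
    · exact (Real.rpow_le_rpow_of_exponent_ge hx h (by linarith)).trans
        (le_add_of_nonneg_left (by positivity))
  have h4 : v ^ (-(t.re + K)) = x ^ (-(t.re + K)) * (v / x) ^ (-(t.re + K)) := by
    rw [← Real.mul_rpow hx.le (by positivity), mul_div_cancel₀ _ hx.ne']
  have h5 : (v / x) ^ (-(t.re + K)) ≤ (1 / (1 + x)) ^ (-(L + K)) * (n + m * x) ^ (-(L + K)) := by
    rw [← Real.mul_rpow (by positivity) (by positivity)]
    exact (Real.rpow_le_rpow_of_exponent_le h1 (by linarith)).trans
      (Real.rpow_le_rpow_of_nonpos (by positivity) h2 (by linarith))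
  calc ‖remInt K t v‖ ≤ C * v ^ (-(t.re + K)) := hC t v hv0 (by linarith)
    _ ≤ C * ((x ^ (-(L + K)) + x ^ (-(M + K))) *
        ((1 / (1 + x)) ^ (-(L + K)) * (n + m * x) ^ (-(L + K)))) := by
      rw [h4]; gcongr
    _ = _ := by ring

theorem norm_pnat_cpow (m : ℕ+) (s : ℂ) : ‖(m : ℂ) ^ (-s)‖ = (m : ℝ) ^ (-s.re) := by
  rw [Complex.norm_natCast_cpow_of_pos m.pos, Complex.neg_re]

theorem exists_summable_remInt_bound (K : ℕ) {x L M : ℝ} (hx : 0 < x) (s : ℂ) (hL : 1 < L + K)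
    (hs : 2 < s.re + (L + K)) :
    ∃ u : ℕ+ × ℕ+ → ℝ, Summable u ∧ ∀ (p : ℕ+ × ℕ+) (t : ℂ), L ≤ t.re → t.re ≤ M →
      ‖(p.2 : ℂ) ^ (-s) * remInt K t (p.1 - 1 + p.2 * x)‖ ≤ u p := by
  obtain ⟨C, hC⟩ := exists_norm_remInt_lattice_le K (M := M) hx (by linarith : 0 ≤ L + K)
  refine ⟨_, (summable_pnat_rpow_mul_add_rpow hx hL hs).mul_left C, fun p t h1 h2 => ?_⟩
  rw [norm_mul, norm_pnat_cpow]
  calc (p.2 : ℝ) ^ (-s.re) * ‖remInt K t (p.1 - 1 + p.2 * x)‖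
      ≤ (p.2 : ℝ) ^ (-s.re) * (C * ((p.1 : ℝ) + p.2 * x) ^ (-(L + K))) := by
        gcongr; exact hC p t h1 h2
    _ = _ := by ring

theorem summable_remInt (K : ℕ) {x : ℝ} (hx : 0 < x) {s t : ℂ} (hL : 1 < t.re + K)
    (hs : 2 < s.re + (t.re + K)) :
    Summable fun p : ℕ+ × ℕ+ => (p.2 : ℂ) ^ (-s) * remInt K t (p.1 - 1 + p.2 * x) := by
  obtain ⟨u, hu, h⟩ := exists_summable_remInt_bound K (M := t.re) hx s hL hs
  exact Summable.of_norm_bounded hu fun p => h p t le_rfl le_rfl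

/-- Weierstrass M-test: the majorant needs an upper bound on `Re t` too, so each point is treated in
a strip around it. -/
theorem differentiableOn_tsum_remInt (K : ℕ) {x L : ℝ} (hx : 0 < x) (s : ℂ) (hL : 1 < L + K)
    (hs : 2 < s.re + (L + K)) :
    DifferentiableOn ℂ (fun t => ∑' p : ℕ+ × ℕ+,
      (p.2 : ℂ) ^ (-s) * remInt K t (p.1 - 1 + p.2 * x)) {t | L < t.re} := by
  intro t ht
  obtain ⟨u, hu, h⟩ := exists_summable_remInt_bound K (M := t.re + 1) hx s hL hs
  have hopen : IsOpen {z : ℂ | L < z.re ∧ z.re < t.re + 1} :=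
    (isOpen_lt continuous_const Complex.continuous_re).inter
      (isOpen_lt Complex.continuous_re continuous_const)
  have := Complex.differentiableOn_tsum_of_summable_norm hu
    (F := fun (p : ℕ+ × ℕ+) t => (p.2 : ℂ) ^ (-s) * remInt K t (p.1 - 1 + p.2 * x))
    (U := {z : ℂ | L < z.re ∧ z.re < t.re + 1})
    (fun p => ((differentiable_remInt K (pnat_shift_pos p hx)).const_mul _).differentiableOn)
    hopen (fun p z hz => h p z hz.1.le hz.2.le)
  exact (this.differentiableAt (hopen.mem_nhds ⟨ht, by simp⟩)).differentiableWithinAt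

/-! ### Euler-Maclaurin for the sum over `n` -/

/-- The main part of the Euler-Maclaurin expansion of `∑_{n ≥ 1} (n + w) ^ (-t)`. -/
noncomputable def emMain (K : ℕ) (t : ℂ) (w : ℝ) : ℂ :=
  (w : ℂ) ^ (1 - t) / (t - 1) +
    ∑ k ∈ Finset.range (K + 1), negBinom t k * riemannZeta (-k) * (w : ℂ) ^ (-t - k)

theorem euler_maclaurin_step {v : ℝ} (hv : 0 < v) {t : ℂ} (ht : t ≠ 1) (K : ℕ) :
    ((v + 1 : ℝ) : ℂ) ^ (-t) = emMain K t v - emMain K t (v + 1)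
      + (-1) ^ K * (negBinom t (K + 1) * remInt (K + 1) t v) := by
  rw [← euler_maclaurin_unit hv ht K]
  simp only [emMain, mul_sub, Finset.sum_sub_distrib]
  ring

theorem tendsto_add_nat_cpow {w : ℝ} {z : ℂ} (hz : z.re < 0) :
    Tendsto (fun n : ℕ => ((w + n : ℝ) : ℂ) ^ z) atTop (𝓝 0) := by
  have h0 : Tendsto (fun n : ℕ => w + (n : ℝ)) atTop atTop :=
    tendsto_atTop_add_const_left _ _ tendsto_natCast_atTop_atTop
  have h1 : Tendsto (fun n : ℕ => (w + n : ℝ) ^ z.re) atTop (𝓝 0) := by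
    have := (tendsto_rpow_neg_atTop (neg_pos.2 hz)).comp h0
    simpa [Function.comp_def] using this
  rw [tendsto_zero_iff_norm_tendsto_zero]
  refine h1.congr' ?_
  filter_upwards [h0.eventually_gt_atTop 0] with n hn
  exact (Complex.norm_cpow_eq_rpow_re_of_pos hn z).symm

theorem tendsto_emMain (K : ℕ) {t : ℂ} (ht : 1 < t.re) (w : ℝ) :
    Tendsto (fun n : ℕ => emMain K t (w + n)) atTop (𝓝 0) := by
  have h1 := (tendsto_add_nat_cpow (w := w) (z := 1 - t) (by simpa using ht)).div_const (t - 1)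
  have h2 := tendsto_finsetSum (Finset.range (K + 1)) fun k _ =>
    (tendsto_add_nat_cpow (w := w) (z := -t - k)
      (by simp only [Complex.sub_re, Complex.neg_re, Complex.natCast_re]
          have : (0 : ℝ) ≤ k := by positivity
          linarith)).const_mul (negBinom t k * riemannZeta (-k))
  simpa [emMain] using h1.add h2

/-- The unit-interval formulas telescope, and the boundary term at `w + N` tends to zero because `Re
t > 1`. -/
theorem tsum_pnat_add_cpow {w : ℝ} (hw : 0 < w) {t : ℂ} (ht : 1 < t.re) (K : ℕ)
    (hf : Summable fun n : ℕ+ => ((n + w : ℝ) : ℂ) ^ (-t))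
    (hR : Summable fun n : ℕ+ => remInt (K + 1) t (n - 1 + w)) :
    ∑' n : ℕ+, ((n + w : ℝ) : ℂ) ^ (-t) = emMain K t w
      + (-1) ^ K * (negBinom t (K + 1) * ∑' n : ℕ+, remInt (K + 1) t (n - 1 + w)) := by
  have ht1 : t ≠ 1 := by rintro rfl; simp at ht
  have hf' : Summable fun n : ℕ => ((w + n + 1 : ℝ) : ℂ) ^ (-t) := by
    have := (summable_pnat_iff_summable_succ (f := fun n : ℕ => ((n + w : ℝ) : ℂ) ^ (-t))).1 hf
    refine this.congr fun n => ?_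
    push_cast; ring_nf
  have hR' : Summable fun n : ℕ => remInt (K + 1) t (w + n) := by
    have := (summable_pnat_iff_summable_succ
      (f := fun n : ℕ => remInt (K + 1) t (n - 1 + w))).1 hR
    refine this.congr fun n => ?_
    push_cast; ring_nf
  have e1 : ∑' n : ℕ+, ((n + w : ℝ) : ℂ) ^ (-t) = ∑' n : ℕ, ((w + n + 1 : ℝ) : ℂ) ^ (-t) := by
    rw [tsum_pnat_eq_tsum_succ (f := fun n : ℕ => ((n + w : ℝ) : ℂ) ^ (-t))]
    refine tsum_congr fun n => ?_
    push_cast; ring_nf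
  have e2 : ∑' n : ℕ+, remInt (K + 1) t (n - 1 + w) = ∑' n : ℕ, remInt (K + 1) t (w + n) := by
    rw [tsum_pnat_eq_tsum_succ (f := fun n : ℕ => remInt (K + 1) t (n - 1 + w))]
    refine tsum_congr fun n => ?_
    push_cast; ring_nf
  rw [e1, e2, ← tsum_mul_left, ← tsum_mul_left]
  have hR'' := (hR'.mul_left (negBinom t (K + 1))).mul_left ((-1) ^ K)
  rw [← sub_eq_iff_eq_add, ← hf'.tsum_sub hR'']
  have hlim := (hf'.sub hR'').hasSum.tendsto_sum_nat
  refine tendsto_nhds_unique hlim ?_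
  have hpart : ∀ N : ℕ, ∑ n ∈ Finset.range N, (((w + n + 1 : ℝ) : ℂ) ^ (-t)
      - (-1) ^ K * (negBinom t (K + 1) * remInt (K + 1) t (w + n)))
      = emMain K t w - emMain K t (w + N) := by
    intro N
    induction N with
    | zero => simp
    | succ N ih =>
      rw [Finset.sum_range_succ, ih, euler_maclaurin_step (v := w + N) (by positivity) ht1 K]
      push_cast
      rw [add_assoc w]
      ring
  simp only [hpart]
  simpa using (tendsto_emMain K ht w).const_sub (emMain K t w)

theorem hasSum_of_eq {ι : Type*} {f g : ι → ℂ} {a b : ℂ} (h : HasSum f a)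
    (hfg : ∀ i, g i = f i) (hab : b = a) : HasSum g b := by
  rw [hab, funext hfg]
  exact h

theorem hasSum_pnat_cpow {z : ℂ} (hz : 1 < z.re) :
    HasSum (fun m : ℕ+ => (m : ℂ) ^ (-z)) (riemannZeta z) := by
  have h1 : Summable fun m : ℕ+ => (m : ℂ) ^ (-z) :=
    Summable.of_norm ((summable_pnat_rpow hz).congr fun m => (norm_pnat_cpow m z).symm)
  convert h1.hasSum using 1
  rw [zeta_eq_tsum_one_div_nat_add_one_cpow hz,
    tsum_pnat_eq_tsum_succ (f := fun n : ℕ => (n : ℂ) ^ (-z))]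
  refine tsum_congr fun n => ?_
  rw [Complex.cpow_neg, one_div]
  push_cast
  rfl

theorem hasSum_pnat_cpow_mul {x : ℝ} (hx : 0 < x) {s z : ℂ} (h : 1 < (s - z).re) :
    HasSum (fun m : ℕ+ => (m : ℂ) ^ (-s) * ((m * x : ℝ) : ℂ) ^ z)
      ((x : ℂ) ^ z * riemannZeta (s - z)) := by
  refine hasSum_of_eq ((hasSum_pnat_cpow h).mul_left ((x : ℂ) ^ z)) (fun m => ?_) rfl
  have hm : (m : ℂ) ≠ 0 := by exact_mod_cast m.ne_zero
  have e : ((m * x : ℝ) : ℂ) ^ z = (m : ℂ) ^ z * (x : ℂ) ^ z := by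
    rw [Complex.ofReal_mul, Complex.mul_cpow_ofReal_nonneg (by positivity) hx.le,
      Complex.ofReal_natCast]
  have e' : -(s - z) = -s + z := by ring
  rw [e, e', Complex.cpow_add _ _ hm]
  ring

/-! ### Expansion of the double series, by induction on `a` -/

/-- The terms of the double series, with `r = -a`. -/
noncomputable def seriesTerm (a : ℕ) (s t : ℂ) (x : ℝ) (p : ℕ+ × ℕ+) : ℂ :=
  (p.1 : ℂ) ^ a * (p.2 : ℂ) ^ (-s) * (((p.1 : ℝ) + p.2 * x : ℝ) : ℂ) ^ (-t)

/-- The coefficient `a! / ((t - 1) ⋯ (t - a - 1))`. -/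
noncomputable def leadCoeff (a : ℕ) (t : ℂ) : ℂ :=
  (a.factorial : ℂ) / ∏ j ∈ Finset.range (a + 1), (t - (j + 1))

/-- The explicit part of the continuation of the double series. -/
noncomputable def mainPart (x : ℝ) (a K : ℕ) (s t : ℂ) : ℂ :=
  leadCoeff a t * (x : ℂ) ^ (a + 1 - t) * riemannZeta (s + t - a - 1) +
    ∑ k ∈ Finset.range K,
      negBinom t k * riemannZeta (-a - k) * (x : ℂ) ^ (-t - k) * riemannZeta (s + t + k)

/-- This is `n = (n + mx) - mx`. -/
theorem seriesTerm_succ (a : ℕ) (s t : ℂ) {x : ℝ} (hx : 0 < x) (p : ℕ+ × ℕ+) :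
    seriesTerm (a + 1) s t x p =
      seriesTerm a s (t - 1) x p - x * seriesTerm a (s - 1) t x p := by
  obtain ⟨n, m⟩ := p
  have hm : (m : ℂ) ≠ 0 := by exact_mod_cast m.ne_zero
  have hw : (((n : ℝ) + m * x : ℝ) : ℂ) ≠ 0 := by
    have : (0 : ℝ) < (n : ℝ) + m * x := by
      have : (0 : ℝ) < n := by exact_mod_cast n.pos
      positivity
    exact_mod_cast this.ne'
  simp only [seriesTerm]
  have e1 : -(t - 1) = -t + 1 := by ring
  have e2 : -(s - 1) = -s + 1 := by ring
  rw [e1, e2, Complex.cpow_add _ _ hw, Complex.cpow_add _ _ hm, Complex.cpow_one,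
    Complex.cpow_one, pow_succ]
  push_cast
  ring

/-- After extracting the common product `P`, this is the partial fraction `1/(t-a-2) - 1/(t-1) =
(a+1)/((t-1)(t-a-2))`. -/
theorem leadCoeff_succ (a : ℕ) {t : ℂ} (ht : (a : ℝ) + 2 < t.re) :
    leadCoeff (a + 1) t = leadCoeff a (t - 1) - leadCoeff a t := by
  have hne : ∀ j : ℕ, j ≤ a + 1 → t - (j + 1) ≠ 0 := by
    intro j hj h
    have h1 := congrArg Complex.re h
    have h2 : (j : ℝ) ≤ a + 1 := by exact_mod_cast hj
    simp at h1
    linarith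
  set P : ℂ := ∏ j ∈ Finset.range a, (t - ((j : ℂ) + 1 + 1)) with hP
  have hP0 : P ≠ 0 := Finset.prod_ne_zero_iff.2 fun j hj => by
    have := hne (j + 1) (by have := Finset.mem_range.1 hj; omega)
    push_cast at this
    exact this
  have h1 : ∏ j ∈ Finset.range (a + 1), (t - 1 - ((j : ℂ) + 1)) = P * (t - ((a : ℂ) + 1 + 1)) := by
    rw [hP, Finset.prod_range_succ]
    congr 1
    · exact Finset.prod_congr rfl fun j _ => by ring
    · ring
  have h2 : ∏ j ∈ Finset.range (a + 1), (t - ((j : ℂ) + 1)) = P * (t - 1) := by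
    rw [hP, Finset.prod_range_succ']
    push_cast
    congr 1
    ring
  have h3 : ∏ j ∈ Finset.range (a + 1 + 1), (t - ((j : ℂ) + 1))
      = P * (t - 1) * (t - ((a : ℂ) + 1 + 1)) := by
    rw [Finset.prod_range_succ, h2]
    push_cast
    ring
  have n1 : t - 1 ≠ 0 := by simpa using hne 0 (by omega)
  have n2 : t - ((a : ℂ) + 1 + 1) ≠ 0 := by
    have := hne (a + 1) le_rfl
    push_cast at this
    exact this
  rw [leadCoeff, leadCoeff, leadCoeff, h1, h2, h3, Nat.factorial_succ]
  push_cast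
  field_simp
  ring

theorem mainPart_succ {x : ℝ} (hx : 0 < x) (a K : ℕ) (s : ℂ) {t : ℂ} (ht : (a : ℝ) + 2 < t.re) :
    mainPart x (a + 1) K s t =
      mainPart x a (K + 1) s (t - 1) - x * mainPart x a (K + 1) (s - 1) t := by
  have hx0 : (x : ℂ) ≠ 0 := by exact_mod_cast hx.ne'
  have hxm : ∀ z : ℂ, (x : ℂ) * (x : ℂ) ^ z = (x : ℂ) ^ (z + 1) := fun z => by
    rw [Complex.cpow_add _ _ hx0, Complex.cpow_one, mul_comm]
  have hsum : ∑ k ∈ Finset.range K, negBinom t k * riemannZeta (-((a + 1 : ℕ) : ℂ) - k) *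
        (x : ℂ) ^ (-t - k) * riemannZeta (s + t + k)
      = ∑ k ∈ Finset.range (K + 1), negBinom (t - 1) k * riemannZeta (-a - k) *
          (x : ℂ) ^ (-(t - 1) - k) * riemannZeta (s + (t - 1) + k)
        - x * ∑ k ∈ Finset.range (K + 1), negBinom t k * riemannZeta (-a - k) *
          (x : ℂ) ^ (-t - k) * riemannZeta (s - 1 + t + k) := by
    rw [Finset.mul_sum, ← Finset.sum_sub_distrib, Finset.sum_range_succ']
    have hz : ∀ k : ℕ, negBinom (t - 1) k * riemannZeta (-a - k) *
          (x : ℂ) ^ (-(t - 1) - k) * riemannZeta (s + (t - 1) + k)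
        - x * (negBinom t k * riemannZeta (-a - k) *
          (x : ℂ) ^ (-t - k) * riemannZeta (s - 1 + t + k))
        = (negBinom (t - 1) k - negBinom t k) * riemannZeta (-a - k) *
          (x : ℂ) ^ (1 - t - k) * riemannZeta (s + t - 1 + k) := by
      intro k
      have e1 : -(t - 1) - (k : ℂ) = 1 - t - k := by ring
      have e2 : s + (t - 1) + (k : ℂ) = s + t - 1 + k := by ring
      have e3 : s - 1 + t + (k : ℂ) = s + t - 1 + k := by ring
      have e4 : (1 : ℂ) - t - k = -t - k + 1 := by ring
      rw [e1, e2, e3, e4, ← hxm]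
      ring
    simp only [hz]
    -- The `k = 0` terms cancel, so the sum shifts by one index: this is why `K + 1` terms for `a`
    -- give `K` terms for `a + 1`.
    rw [negBinom_zero, negBinom_zero, sub_self, zero_mul, zero_mul, zero_mul, add_zero]
    refine Finset.sum_congr rfl fun k _ => ?_
    rw [negBinom_pascal]
    have e1 : -((a + 1 : ℕ) : ℂ) - k = -a - ((k + 1 : ℕ) : ℂ) := by push_cast; ring
    have e2 : -t - (k : ℂ) = 1 - t - ((k + 1 : ℕ) : ℂ) := by push_cast; ring
    have e3 : s + t + (k : ℂ) = s + t - 1 + ((k + 1 : ℕ) : ℂ) := by push_cast; ring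
    rw [e1, e2, e3]
  rw [mainPart, mainPart, mainPart, hsum, leadCoeff_succ a ht]
  have e1 : ((a + 1 : ℕ) : ℂ) + 1 - t = a + 1 - t + 1 := by push_cast; ring
  have e2 : (a : ℂ) + 1 - (t - 1) = a + 1 - t + 1 := by ring
  have e3 : s + t - ((a + 1 : ℕ) : ℂ) - 1 = s + t - a - 2 := by push_cast; ring
  have e4 : s + (t - 1) - (a : ℂ) - 1 = s + t - a - 2 := by ring
  have e5 : s - 1 + t - (a : ℂ) - 1 = s + t - a - 2 := by ring
  rw [e1, e2, e3, e4, e5, ← hxm]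
  ring

/-- The remainder of the expansion in the case `r = 0`. -/
noncomputable def remSeries (x : ℝ) (K : ℕ) (s t : ℂ) : ℂ :=
  ∑' p : ℕ+ × ℕ+, (p.2 : ℂ) ^ (-s) * remInt K t (p.1 - 1 + p.2 * x)

theorem summable_seriesTerm_zero {x : ℝ} (hx : 0 < x) {s t : ℂ} (ht : 1 < t.re)
    (hst : 2 < s.re + t.re) : Summable (seriesTerm 0 s t x) := by
  refine Summable.of_norm ((summable_pnat_rpow_mul_add_rpow hx ht hst).congr fun p => ?_)
  have hn : (0 : ℝ) < p.1 := by exact_mod_cast p.1.pos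
  rw [seriesTerm, pow_zero, one_mul, norm_mul, norm_pnat_cpow,
    Complex.norm_cpow_eq_rpow_re_of_pos (by positivity), Complex.neg_re]

theorem hasSum_emMain {x : ℝ} (hx : 0 < x) (K : ℕ) {s t : ℂ} (hst : 2 < s.re + t.re) :
    HasSum (fun m : ℕ+ => (m : ℂ) ^ (-s) * emMain K t (m * x)) (mainPart x 0 (K + 1) s t) := by
  have h1 := (hasSum_pnat_cpow_mul hx (s := s) (z := 1 - t) (by simp; linarith)).mul_left
    ((t - 1)⁻¹)
  have h2 := hasSum_sum (s := Finset.range (K + 1)) fun k _ =>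
    (hasSum_pnat_cpow_mul hx (s := s) (z := -t - k) (by
      have : (0 : ℝ) ≤ k := by positivity
      simp; linarith)).mul_left (negBinom t k * riemannZeta (-k))
  have h3 := h1.add h2
  have e : (t - 1)⁻¹ * ((x : ℂ) ^ (1 - t) * riemannZeta (s - (1 - t))) +
      ∑ k ∈ Finset.range (K + 1), negBinom t k * riemannZeta (-k) *
        ((x : ℂ) ^ (-t - k) * riemannZeta (s - (-t - k))) = mainPart x 0 (K + 1) s t := by
    rw [mainPart, leadCoeff]
    congr 1
    · have : s - (1 - t) = s + t - 1 := by ring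
      simp [this, mul_assoc]
    · refine Finset.sum_congr rfl fun k _ => ?_
      have : s - (-t - k) = s + t + k := by ring
      simp [this, mul_assoc]
  rw [← e]
  refine hasSum_of_eq h3 (fun m => ?_) rfl
  rw [emMain, mul_add, Finset.mul_sum]
  congr 1
  · ring
  · exact Finset.sum_congr rfl fun k _ => by ring

/-- Absolute convergence allows summing over `n` first, for fixed `m`; hence the coordinate swaps in
the proof. -/
theorem hasSum_seriesTerm_zero {x : ℝ} (hx : 0 < x) (K : ℕ) {s t : ℂ} (ht : 1 < t.re)
    (hst : 2 < s.re + t.re) :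
    HasSum (seriesTerm 0 s t x) (mainPart x 0 (K + 1) s t +
      (-1) ^ K * (negBinom t (K + 1) * remSeries x (K + 1) s t)) := by
  have hK : (0 : ℝ) ≤ ((K + 1 : ℕ) : ℝ) := by positivity
  have hf := summable_seriesTerm_zero hx ht hst
  have hR := summable_remInt (K + 1) hx (s := s) (t := t) (by linarith) (by linarith)
  have hf' := hf.prod_symm
  have hR' := hR.prod_symm
  have hm : ∀ m : ℕ+, (m : ℂ) ^ (-s) ≠ 0 := fun m => by
    rw [Complex.cpow_def_of_ne_zero (by exact_mod_cast m.ne_zero)]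
    exact Complex.exp_ne_zero _
  have hfib : ∀ m : ℕ+, ∑' n : ℕ+, seriesTerm 0 s t x (n, m) = (m : ℂ) ^ (-s) * emMain K t (m * x)
      + (-1) ^ K * (negBinom t (K + 1) * ∑' n : ℕ+, (m : ℂ) ^ (-s) *
        remInt (K + 1) t (n - 1 + m * x)) := by
    intro m
    have hmx : 0 < (m : ℝ) * x := by
      have : (0 : ℝ) < m := by exact_mod_cast m.pos
      positivity
    have h1 := hf'.prod_factor m
    have h2 := hR'.prod_factor m
    simp only [seriesTerm, Prod.swap, pow_zero, one_mul] at h1 h2 ⊢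
    rw [tsum_mul_left, tsum_mul_left, tsum_pnat_add_cpow hmx ht K
      ((summable_mul_left_iff (hm m)).1 h1) ((summable_mul_left_iff (hm m)).1 h2)]
    ring
  have hRm := hR'.hasSum.prod_fiberwise fun m => (hR'.prod_factor m).hasSum
  have htot := (hasSum_emMain hx K hst).add
    ((hRm.mul_left (negBinom t (K + 1))).mul_left ((-1) ^ K))
  have hfm := hf'.hasSum.prod_fiberwise fun m => (hf'.prod_factor m).hasSum
  have heq : ∑' p : ℕ+ × ℕ+, seriesTerm 0 s t x p.swap = mainPart x 0 (K + 1) s t +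
      (-1) ^ K * (negBinom t (K + 1) * remSeries x (K + 1) s t) := by
    refine hfm.unique ?_
    have e : remSeries x (K + 1) s t = ∑' p : ℕ+ × ℕ+, (p.swap.2 : ℂ) ^ (-s) *
        remInt (K + 1) t (p.swap.1 - 1 + p.swap.2 * x) :=
      ((Equiv.prodComm ℕ+ ℕ+).tsum_eq fun p : ℕ+ × ℕ+ =>
        (p.2 : ℂ) ^ (-s) * remInt (K + 1) t (p.1 - 1 + p.2 * x)).symm
    rw [e]
    refine hasSum_of_eq htot (fun m => ?_) rfl
    exact hfib m
  rw [← heq]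
  have := (Equiv.prodComm ℕ+ ℕ+).tsum_eq (seriesTerm 0 s t x)
  exact (this.symm ▸ hf.hasSum)

/-- The induction must run over all `s` and `L`, since the recursion uses `(s, t - 1)` and `(s - 1,
t)`. The vanishing at `-N` starts from the binomial factor and survives the shift `t - 1` because
`K` drops by one at the same time. -/
theorem exists_expansion {x : ℝ} (hx : 0 < x) (a : ℕ) : ∀ (s : ℂ) (L : ℝ), ∀ᶠ K : ℕ in atTop,
    ∃ E : ℂ → ℂ, DifferentiableOn ℂ E {t | L < t.re} ∧ (∀ N : ℕ, N < K → E (-N) = 0) ∧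
      ∀ t : ℂ, (-(a : ℂ), s, t) ∈ region →
        HasSum (seriesTerm a s t x) (mainPart x a K s t + E t) := by
  induction a with
  | zero =>
    intro s L
    have h1 := tendsto_natCast_atTop_atTop (R := ℝ).eventually_gt_atTop (1 - L)
    have h2 := tendsto_natCast_atTop_atTop (R := ℝ).eventually_gt_atTop (2 - L - s.re)
    filter_upwards [h1, h2, eventually_ge_atTop 1] with K h1 h2 hK
    obtain ⟨K, rfl⟩ := Nat.exists_eq_add_of_le' hK
    refine ⟨fun t => (-1) ^ K * (negBinom t (K + 1) * remSeries x (K + 1) s t), ?_, ?_, ?_⟩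
    · exact (((differentiable_negBinom (K + 1)).differentiableOn).mul
        (differentiableOn_tsum_remInt (K + 1) hx s (by linarith) (by linarith))).const_mul _
    · intro N hN
      simp [negBinom_neg_eq_zero hN]
    · intro t ht
      simp only [region, mem_ofPred_eq, Complex.add_re, Nat.cast_zero, neg_zero,
        Complex.zero_re, zero_add] at ht
      exact hasSum_seriesTerm_zero hx K ht.1 ht.2.2
  | succ a ih =>
    intro s L
    have h1 := (tendsto_add_atTop_nat 1).eventually (ih s (L - 1))
    have h2 := (tendsto_add_atTop_nat 1).eventually (ih (s - 1) L)
    filter_upwards [h1, h2] with K ⟨E₁, hE₁, hv₁, hs₁⟩ ⟨E₂, hE₂, hv₂, hs₂⟩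
    refine ⟨fun t => E₁ (t - 1) - x * E₂ t, ?_, ?_, ?_⟩
    · refine (hE₁.comp (by fun_prop) fun t ht => ?_).sub (hE₂.const_mul _)
      simpa using ht
    · intro N hN
      have e : -(N : ℂ) - 1 = -((N + 1 : ℕ) : ℂ) := by push_cast; ring
      simp only [e, hv₁ (N + 1) (by omega), hv₂ N (by omega)]
      simp
    · intro t ht
      simp only [region, mem_ofPred_eq, Complex.add_re, Complex.neg_re, Complex.natCast_re] at ht
      push_cast at ht
      obtain ⟨ha, hb, hc⟩ := ht
      rw [mainPart_succ hx a K s (by linarith)]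
      have r1 : (-(a : ℂ), s, t - 1) ∈ region := by
        simp only [region, mem_ofPred_eq, Complex.add_re, Complex.neg_re, Complex.natCast_re,
          Complex.sub_re, Complex.one_re]
        have : (0 : ℝ) ≤ a := by positivity
        refine ⟨?_, ?_, ?_⟩ <;> linarith
      have r2 : (-(a : ℂ), s - 1, t) ∈ region := by
        simp only [region, mem_ofPred_eq, Complex.add_re, Complex.neg_re, Complex.natCast_re,
          Complex.sub_re, Complex.one_re]
        have : (0 : ℝ) ≤ a := by positivity
        refine ⟨?_, ?_, ?_⟩ <;> linarith
      have := (hs₁ _ r1).sub ((hs₂ _ r2).mul_left (x : ℂ))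
      exact hasSum_of_eq this (seriesTerm_succ a s t hx) (by ring)

/-! ### Meromorphy of the explicit part -/

/-- The Riemann zeta function with its pole removed. -/
noncomputable def zetaReg : ℂ → ℂ :=
  Function.update (fun z => riemannZeta z - 1 / (z - 1)) 1 (Real.eulerMascheroniConstant : ℂ)

theorem zetaReg_one : zetaReg 1 = (Real.eulerMascheroniConstant : ℂ) := by simp [zetaReg]

theorem riemannZeta_eq_add_zetaReg {z : ℂ} (hz : z ≠ 1) :
    riemannZeta z = 1 / (z - 1) + zetaReg z := by
  simp [zetaReg, Function.update_of_ne hz]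

theorem differentiable_zetaReg : Differentiable ℂ zetaReg := by
  rw [← differentiableOn_univ,
    ← Complex.differentiableOn_compl_singleton_and_continuousAt_iff (c := 1) univ_mem]
  refine ⟨fun z hz => ?_, ?_⟩
  · have hz1 : z ≠ 1 := hz.2
    have h : DifferentiableAt ℂ (fun z => riemannZeta z - 1 / (z - 1)) z :=
      (differentiableAt_riemannZeta hz1).sub
        ((differentiableAt_const _).div (by fun_prop) (sub_ne_zero.2 hz1))
    refine (h.congr_of_eventuallyEq ?_).differentiableWithinAt
    filter_upwards [isOpen_ne.mem_nhds hz1] with w hw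
    exact Function.update_of_ne hw _ _
  · rw [zetaReg, continuousAt_update_same]
    exact tendsto_riemannZeta_sub_one_div

theorem analyticAt_riemannZeta {z : ℂ} (hz : z ≠ 1) : AnalyticAt ℂ riemannZeta z := by
  have : DifferentiableOn ℂ riemannZeta {1}ᶜ := fun w hw =>
    (differentiableAt_riemannZeta hw).differentiableWithinAt
  exact this.analyticAt (isOpen_ne.mem_nhds hz)

theorem meromorphicAt_riemannZeta_add (c z : ℂ) :
    MeromorphicAt (fun t => riemannZeta (c + t)) z := by
  have h : MeromorphicAt (fun t => 1 / (c + t - 1) + zetaReg (c + t)) z :=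
    ((MeromorphicAt.const 1 z).fun_div
      (((MeromorphicAt.const c z).fun_add (MeromorphicAt.id z)).fun_sub
        (MeromorphicAt.const 1 z))).fun_add
      ((differentiable_zetaReg.comp (differentiable_id.const_add c)).analyticAt z).meromorphicAt
  refine h.congr ?_
  have : ∀ᶠ w in 𝓝[≠] z, w ≠ 1 - c := by
    rcases eq_or_ne z (1 - c) with rfl | hz
    · exact self_mem_nhdsWithin
    · exact mem_nhdsWithin_of_mem_nhds (isOpen_ne.mem_nhds hz)
  filter_upwards [this] with w hw
  refine (riemannZeta_eq_add_zetaReg fun h => hw ?_).symm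
  rw [← h]; ring

theorem differentiable_ofReal_cpow {x : ℝ} (hx : 0 < x) {f : ℂ → ℂ} (hf : Differentiable ℂ f) :
    Differentiable ℂ fun t => (x : ℂ) ^ f t := by
  have hx0 : (x : ℂ) ≠ 0 := by exact_mod_cast hx.ne'
  exact fun t => (hf t).const_cpow (Or.inl hx0)

theorem meromorphicAt_mainPart {x : ℝ} (hx : 0 < x) (a K : ℕ) (s z : ℂ) :
    MeromorphicAt (mainPart x a K s) z := by
  unfold mainPart leadCoeff
  refine MeromorphicAt.fun_add ?_ ?_
  · have e : ∀ t : ℂ, s + t - a - 1 = s - a - 1 + t := fun t => by ring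
    simp only [e]
    have h1 : Differentiable ℂ fun t : ℂ => ∏ j ∈ Finset.range (a + 1), (t - ((j : ℂ) + 1)) := by
      fun_prop
    have h2 := differentiable_ofReal_cpow hx (f := fun t : ℂ => a + 1 - t) (by fun_prop)
    exact (((MeromorphicAt.const _ z).fun_div (h1.analyticAt z).meromorphicAt).fun_mul
      (h2.analyticAt z).meromorphicAt).fun_mul (meromorphicAt_riemannZeta_add _ z)
  · refine MeromorphicAt.fun_sum fun k _ => ?_
    have e : ∀ t : ℂ, s + t + k = s + k + t := fun t => by ring
    simp only [e]
    have h2 := differentiable_ofReal_cpow hx (f := fun t : ℂ => -t - k) (by fun_prop)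
    exact ((((differentiable_negBinom k).mul_const _).mul h2).analyticAt z).meromorphicAt.fun_mul
      (meromorphicAt_riemannZeta_add _ z)

theorem leadCoeff_denom_ne_zero (a : ℕ) {t : ℂ} (ht : ∀ j : ℕ, j ≤ a → t ≠ j + 1) :
    ∏ j ∈ Finset.range (a + 1), (t - ((j : ℂ) + 1)) ≠ 0 :=
  Finset.prod_ne_zero_iff.2 fun j hj =>
    sub_ne_zero.2 (ht j (Nat.lt_succ_iff.1 (Finset.mem_range.1 hj)))

theorem differentiableAt_leadCoeff (a : ℕ) {t : ℂ} (ht : ∀ j : ℕ, j ≤ a → t ≠ j + 1) :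
    DifferentiableAt ℂ (leadCoeff a) t := by
  unfold leadCoeff
  exact (differentiableAt_const _).div (by fun_prop) (leadCoeff_denom_ne_zero a ht)

theorem isOpen_region_slice (r s : ℂ) : IsOpen {t : ℂ | (r, s, t) ∈ region} := by
  have h : ∀ c d : ℝ, IsOpen {t : ℂ | c < d + t.re} := fun c d =>
    isOpen_lt continuous_const (continuous_const.add Complex.continuous_re)
  simp only [region, mem_ofPred_eq, Complex.add_re]
  exact (h 1 r.re).inter ((h 1 s.re).inter (h 2 (r.re + s.re)))

theorem one_lt_re_of_mem_region {a : ℕ} {s t : ℂ} (ht : (-(a : ℂ), s, t) ∈ region) :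
    (a : ℝ) + 1 < t.re := by
  have := ht.1
  simp only [Complex.add_re, Complex.neg_re, Complex.natCast_re] at this
  linarith

/-- In the region every zeta argument has real part above `1` and `Re t > a + 1` avoids the zeros of
the denominator. Analyticity ensures that passing to normal form does not alter values there. -/
theorem analyticAt_mainPart {x : ℝ} (hx : 0 < x) (a K : ℕ) {s t : ℂ}
    (ht : (-(a : ℂ), s, t) ∈ region) : AnalyticAt ℂ (mainPart x a K s) t := by
  have hd : DifferentiableOn ℂ (mainPart x a K s) {t | (-(a : ℂ), s, t) ∈ region} := by
    intro t ht
    have h1 := one_lt_re_of_mem_region ht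
    have ht' : (-(a : ℂ), s, t) ∈ region := ht
    simp only [region, mem_ofPred_eq, Complex.add_re, Complex.neg_re, Complex.natCast_re] at ht'
    obtain ⟨-, h2, h3⟩ := ht'
    refine DifferentiableAt.differentiableWithinAt ?_
    unfold mainPart
    refine DifferentiableAt.fun_add ?_ (DifferentiableAt.fun_sum fun k _ => ?_)
    · refine DifferentiableAt.fun_mul (DifferentiableAt.fun_mul
        (differentiableAt_leadCoeff a fun j hj h => ?_)
        (differentiable_ofReal_cpow hx (by fun_prop) t)) ?_
      · have h4 : (j : ℝ) ≤ a := by exact_mod_cast hj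
        rw [h] at h1
        simp at h1
        linarith
      · refine (differentiableAt_riemannZeta fun h => ?_).comp t
          (f := fun t => s + t - (a : ℂ) - 1) (by fun_prop)
        have := congrArg Complex.re h
        simp at this
        linarith
    · refine DifferentiableAt.fun_mul (DifferentiableAt.fun_mul
        ((differentiable_negBinom k).mul_const _ t)
        (differentiable_ofReal_cpow hx (by fun_prop) t)) ?_
      refine (differentiableAt_riemannZeta fun h => ?_).comp t
          (f := fun t => s + t + (k : ℂ)) (by fun_prop)
      have := congrArg Complex.re h
      have hk : (0 : ℝ) ≤ k := by positivity
      simp at this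
      linarith
  exact hd.analyticAt ((isOpen_region_slice _ _).mem_nhds ht)

/-! ### Existence of the continuation -/

theorem thetaSeries_eq_tsum_seriesTerm (a : ℕ) (s t : ℂ) (x : ℝ) :
    thetaSeries (-(a : ℂ)) s t x = ∑' p, seriesTerm a s t x p := by
  refine tsum_congr fun p => ?_
  rw [seriesTerm, Complex.cpow_neg, Complex.cpow_neg, Complex.cpow_neg, Complex.cpow_natCast]
  push_cast
  rw [one_div, mul_inv, mul_inv, inv_inv]

theorem isOpen_halfPlane (L : ℝ) : IsOpen {t : ℂ | L < t.re} :=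
  isOpen_lt continuous_const Complex.continuous_re

theorem exists_mem_region (r s : ℂ) (L : ℝ) : ∃ t : ℂ, L < t.re ∧ (r, s, t) ∈ region := by
  refine ⟨((3 + |L| + |r.re| + |s.re| : ℝ) : ℂ), ?_, ?_⟩
  · rw [Complex.ofReal_re]
    linarith [le_abs_self L, abs_nonneg r.re, abs_nonneg s.re]
  · change 1 < (r + _).re ∧ 1 < (s + _).re ∧ 2 < (r + s + _).re
    simp only [Complex.add_re, Complex.ofReal_re]
    have h1 := neg_abs_le r.re
    have h2 := neg_abs_le s.re
    have h3 := abs_nonneg L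
    have h4 := abs_nonneg r.re
    have h5 := abs_nonneg s.re
    refine ⟨?_, ?_, ?_⟩ <;> linarith

/-- Identity theorem: infinite order of `F - G` at one point of the region propagates through the
connected half-plane. -/
theorem eventuallyEq_of_eq_on_region {r s : ℂ} {L : ℝ} {F G : ℂ → ℂ}
    (hF : MeromorphicOn F {t | L < t.re}) (hG : MeromorphicOn G {t | L < t.re})
    (h : ∀ t : ℂ, L < t.re → (r, s, t) ∈ region → F t = G t) {z : ℂ} (hz : L < z.re) :
    F =ᶠ[𝓝[≠] z] G := by
  obtain ⟨w, hwL, hw⟩ := exists_mem_region r s L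
  have hM : MeromorphicOn (F - G) {t | L < t.re} := hF.sub hG
  have htop : meromorphicOrderAt (F - G) w = ⊤ := by
    rw [meromorphicOrderAt_eq_top_iff]
    refine Filter.Eventually.filter_mono nhdsWithin_le_nhds ?_
    filter_upwards [(isOpen_halfPlane L).mem_nhds hwL, (isOpen_region_slice r s).mem_nhds hw]
      with t h1 h2
    exact sub_eq_zero.2 (h t h1 h2)
  have hztop : meromorphicOrderAt (F - G) z = ⊤ := by
    by_contra hne
    exact hM.meromorphicOrderAt_ne_top_of_isPreconnected
      (convex_halfSpace_re_gt L).isPreconnected hz hwL hne htop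
  filter_upwards [meromorphicOrderAt_eq_top_iff.1 hztop] with t ht
  exact sub_eq_zero.1 ht

theorem exists_meromorphicNFOn_halfPlane {x : ℝ} (hx : 0 < x) (a : ℕ) (s : ℂ) {L : ℝ}
    (hL : L ≤ 0) : ∃ G : ℂ → ℂ, MeromorphicNFOn G {t | L < t.re} ∧
      ∀ t : ℂ, (-(a : ℂ), s, t) ∈ region → G t = thetaSeries (-(a : ℂ)) s t x := by
  obtain ⟨K, E, hE, -, hs⟩ := (exists_expansion hx a s L).exists
  have hEan : ∀ t : ℂ, L < t.re → AnalyticAt ℂ E t := fun t ht =>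
    hE.analyticAt ((isOpen_halfPlane L).mem_nhds ht)
  have hmer : MeromorphicOn (mainPart x a K s + E) {t | L < t.re} := fun t ht =>
    (meromorphicAt_mainPart hx a K s t).add (hEan t ht).meromorphicAt
  refine ⟨toMeromorphicNFOn (mainPart x a K s + E) {t | L < t.re},
    meromorphicNFOn_toMeromorphicNFOn _ _, fun t ht => ?_⟩
  have htL : L < t.re := by
    have h1 := one_lt_re_of_mem_region ht
    have h2 : (0 : ℝ) ≤ a := by positivity
    linarith
  rw [toMeromorphicNFOn_eq_toMeromorphicNFAt hmer htL,
    toMeromorphicNFAt_eq_self.2 ((analyticAt_mainPart hx a K ht).add (hEan t htL)).meromorphicNFAt,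
    thetaSeries_eq_tsum_seriesTerm]
  exact (hs t ht).tsum_eq.symm

/-- Glues the functions on `Re t > -j`. Normal form upgrades agreement on punctured neighbourhoods
to pointwise agreement, so the choice of `j` at each `t` is immaterial. -/
theorem exists_isContinuation {x : ℝ} (hx : 0 < x) (a : ℕ) (s : ℂ) :
    ∃ F, IsContinuation (-(a : ℂ)) s x F := by
  choose G hG hser using fun j : ℕ => exists_meromorphicNFOn_halfPlane hx a s
    (L := -(j : ℝ)) (by simp)
  have hle : ∀ i j : ℕ, i ≤ j → ∀ t : ℂ, -(i : ℝ) < t.re → G i t = G j t := by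
    intro i j hij t ht
    have hij' : (i : ℝ) ≤ j := by exact_mod_cast hij
    have hsub : {t : ℂ | -(i : ℝ) < t.re} ⊆ {t | -(j : ℝ) < t.re} := fun w hw => by
      have : -(i : ℝ) < w.re := hw
      change -(j : ℝ) < w.re
      linarith
    have h := eventuallyEq_of_eq_on_region (hG i).meromorphicOn
      ((hG j).meromorphicOn.mono_set hsub) (fun w _ hw => (hser i w hw).trans (hser j w hw).symm) ht
    exact (((hG i ht).eventuallyEq_nhdsNE_iff_eventuallyEq_nhds (hG j (hsub ht))).1 h).eq_of_nhds
  have heq : ∀ i j : ℕ, ∀ t : ℂ, -(i : ℝ) < t.re → -(j : ℝ) < t.re → G i t = G j t := by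
    intro i j t hi hj
    rcases le_total i j with h | h
    · exact hle i j h t hi
    · exact (hle j i h t hj).symm
  have hidx : ∀ t : ℂ, -((⌈-t.re⌉₊ + 1 : ℕ) : ℝ) < t.re := fun t => by
    have := Nat.le_ceil (-t.re)
    push_cast
    linarith
  refine ⟨fun t => G (⌈-t.re⌉₊ + 1) t, fun t _ => ?_, fun t ht => hser _ t ht⟩
  refine (meromorphicNFAt_congr ?_).2 (hG (⌈-t.re⌉₊ + 1) (hidx t))
  filter_upwards [(isOpen_halfPlane _).mem_nhds (hidx t)] with w hw
  exact heq _ _ w (hidx w) hw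

theorem isContinuation_Theta {x : ℝ} (hx : 0 < x) (a : ℕ) (s : ℂ) :
    IsContinuation (-(a : ℂ)) s x fun t => Theta (-(a : ℂ)) s t x := by
  have h := exists_isContinuation hx a s
  have e : (fun t => Theta (-(a : ℂ)) s t x) = h.choose := by
    funext t
    rw [Theta, dif_pos h]
  rw [e]
  exact h.choose_spec

theorem eventually_exists_Theta_eventuallyEq {x : ℝ} (hx : 0 < x) (a : ℕ) (s t₀ : ℂ) :
    ∀ᶠ K : ℕ in atTop, ∃ E : ℂ → ℂ, AnalyticAt ℂ E t₀ ∧ (∀ N : ℕ, N < K → E (-N) = 0) ∧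
      (fun t => Theta (-(a : ℂ)) s t x) =ᶠ[𝓝[≠] t₀] fun t => mainPart x a K s t + E t := by
  filter_upwards [exists_expansion hx a s (t₀.re - 1)] with K ⟨E, hE, hv, hs⟩
  have hEan : ∀ t : ℂ, t₀.re - 1 < t.re → AnalyticAt ℂ E t := fun t ht =>
    hE.analyticAt ((isOpen_halfPlane _).mem_nhds ht)
  refine ⟨E, hEan t₀ (by simp), hv, ?_⟩
  have hT := isContinuation_Theta hx a s
  refine eventuallyEq_of_eq_on_region (r := -(a : ℂ)) (s := s) (L := t₀.re - 1)
    (hT.meromorphic.meromorphicOn.mono_set (subset_univ _))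
    (fun t ht => (meromorphicAt_mainPart hx a K s t).add (hEan t ht).meromorphicAt)
    (fun t _ ht => ?_) (by simp)
  rw [hT.eq_series t ht, thetaSeries_eq_tsum_seriesTerm]
  exact (hs t ht).tsum_eq

/-! ### Laurent data at a simple pole -/

/-- `f` has at most a simple pole at `t₀`, with residue `α` and constant term `β`. -/
def LaurentAt (f : ℂ → ℂ) (t₀ α β : ℂ) : Prop :=
  ∃ h : ℂ → ℂ, AnalyticAt ℂ h t₀ ∧ h t₀ = β ∧ f =ᶠ[𝓝[≠] t₀] fun t => α / (t - t₀) + h t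

namespace LaurentAt

variable {f g : ℂ → ℂ} {t₀ α β α' β' : ℂ}

theorem of_analyticAt (hf : AnalyticAt ℂ f t₀) : LaurentAt f t₀ 0 (f t₀) :=
  ⟨f, hf, rfl, Eventually.of_forall fun t => by simp⟩

theorem congr (hf : LaurentAt f t₀ α β) (hg : g =ᶠ[𝓝[≠] t₀] f) : LaurentAt g t₀ α β := by
  obtain ⟨h, h1, h2, h3⟩ := hf
  exact ⟨h, h1, h2, hg.trans h3⟩

theorem add (hf : LaurentAt f t₀ α β) (hg : LaurentAt g t₀ α' β') :
    LaurentAt (fun t => f t + g t) t₀ (α + α') (β + β') := by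
  obtain ⟨h, h1, h2, h3⟩ := hf
  obtain ⟨k, k1, k2, k3⟩ := hg
  refine ⟨fun t => h t + k t, h1.fun_add k1, by simp only [h2, k2], ?_⟩
  filter_upwards [h3, k3] with t h4 k4
  rw [h4, k4]
  ring

theorem sum {ι : Type*} (S : Finset ι) {F : ι → ℂ → ℂ} {A B : ι → ℂ}
    (h : ∀ i, LaurentAt (F i) t₀ (A i) (B i)) :
    LaurentAt (fun t => ∑ i ∈ S, F i t) t₀ (∑ i ∈ S, A i) (∑ i ∈ S, B i) := by
  classical
  induction S using Finset.induction_on with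
  | empty => simpa using of_analyticAt (f := fun _ => (0 : ℂ)) (t₀ := t₀) analyticAt_const
  | insert i S hi ih =>
    simp only [Finset.sum_insert hi]
    exact (h i).add ih

/-- From `ζ(1 + h) = 1/h + γ + O(h)`: at `u = 1` the quotient `g t / (t - t₀)` splits into the pole
`g t₀ / (t - t₀)` and the analytic slope `dslope g t₀`, whose value at `t₀` is `g'(t₀)`. -/
theorem mul_riemannZeta (hg : AnalyticAt ℂ g t₀) (u : ℂ) :
    LaurentAt (fun t => g t * riemannZeta (u + (t - t₀))) t₀ (if u = 1 then g t₀ else 0)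
      (if u = 1 then deriv g t₀ + (Real.eulerMascheroniConstant : ℂ) * g t₀
        else g t₀ * riemannZeta u) := by
  by_cases hu : u = 1
  · subst hu
    simp only [if_true]
    have hd : AnalyticAt ℂ (dslope g t₀) t₀ := by
      obtain ⟨p, hp⟩ := hg
      exact hp.has_fpower_series_dslope_fslope.analyticAt
    have hz : AnalyticAt ℂ (fun t => zetaReg (1 + (t - t₀))) t₀ :=
      (differentiable_zetaReg.comp (by fun_prop : Differentiable ℂ fun t => 1 + (t - t₀))).analyticAt
        t₀
    refine ⟨fun t => dslope g t₀ t + g t * zetaReg (1 + (t - t₀)), hd.fun_add (hg.fun_mul hz), ?_, ?_⟩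
    · simp only [dslope_same, sub_self, add_zero, zetaReg_one]
      ring
    · filter_upwards [self_mem_nhdsWithin] with t ht
      have ht' : t - t₀ ≠ 0 := sub_ne_zero.2 ht
      rw [riemannZeta_eq_add_zetaReg (by simpa using ht'), add_sub_cancel_left, dslope_of_ne _ ht, slope_def_field]
      field_simp
      ring
  · simp only [if_neg hu]
    have hz : AnalyticAt ℂ (fun t => riemannZeta (u + (t - t₀))) t₀ := by
      have h1 : AnalyticAt ℂ riemannZeta (u + (t₀ - t₀)) := by
        rw [sub_self, add_zero]; exact analyticAt_riemannZeta hu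
      exact h1.fun_comp (f := fun t => u + (t - t₀)) (by fun_prop)
    have := of_analyticAt (hg.fun_mul hz)
    simpa using this

theorem isBigO (hf : LaurentAt f t₀ α β) :
    (fun t => f t - (α / (t - t₀) + β)) =O[𝓝[≠] t₀] fun t => t - t₀ := by
  obtain ⟨h, h1, h2, h3⟩ := hf
  have := h1.differentiableAt.isBigO_sub.mono (nhdsWithin_le_nhds (s := {t₀}ᶜ))
  refine this.congr' ?_ EventuallyEq.rfl
  filter_upwards [h3] with t ht
  rw [ht, h2]
  ring

/-- Normal form fills the removable singularity with the limit value, so the estimate holds at `t₀`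
itself. -/
theorem analyticAt_and_isBigO (hf : LaurentAt f t₀ 0 β) (hNF : MeromorphicNFAt f t₀) :
    AnalyticAt ℂ f t₀ ∧ (fun t => f t - β) =O[𝓝 t₀] fun t => t - t₀ := by
  obtain ⟨h, h1, h2, h3⟩ := hf
  have h4 : f =ᶠ[𝓝[≠] t₀] h := by
    filter_upwards [h3] with t ht
    rw [ht, zero_div, zero_add]
  have h5 := (hNF.eventuallyEq_nhdsNE_iff_eventuallyEq_nhds h1.meromorphicNFAt).1 h4
  refine ⟨h1.congr h5.symm, h1.differentiableAt.isBigO_sub.congr' ?_ EventuallyEq.rfl⟩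
  filter_upwards [h5] with t ht
  rw [ht, h2]

end LaurentAt

/-! ### Values and derivatives of the coefficients at `t = -N` -/

/-- The harmonic numbers as complex numbers. -/
noncomputable def harm (n : ℕ) : ℂ := ((harmonic n : ℚ) : ℂ)

theorem harm_succ (n : ℕ) : harm (n + 1) = harm n + 1 / ((n : ℂ) + 1) := by
  rw [harm, harm, harmonic_succ]
  push_cast
  rw [one_div]

theorem negBinom_neg_nat {N k : ℕ} (h : k ≤ N) : negBinom (-(N : ℂ)) k = (N.choose k : ℂ) := by
  induction k with
  | zero => simp [negBinom_zero]
  | succ k ih =>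
    have h2 : ((k : ℂ) + 1) ≠ 0 := by exact_mod_cast k.succ_ne_zero
    have h3 : ((N.choose (k + 1) : ℕ) : ℂ) * (k + 1) = N.choose k * (N - k) := by
      have := Nat.choose_succ_right_eq N k
      have h4 : ((N - k : ℕ) : ℂ) = N - k := Nat.cast_sub (by omega)
      rw [← h4]
      exact_mod_cast this
    rw [negBinom_succ_right, ih (by omega), neg_neg, ← h3, mul_div_cancel_right₀ _ h2]

theorem hasDerivAt_negBinom_succ {t d : ℂ} {k : ℕ} (h : HasDerivAt (fun t => negBinom t k) d t) :
    HasDerivAt (fun t => negBinom t (k + 1)) ((d * (-t - k) - negBinom t k) / (k + 1)) t := by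
  simp only [negBinom_succ_right]
  have h1 : HasDerivAt (fun t : ℂ => -t - (k : ℂ)) (-1) t :=
    (hasDerivAt_id t).fun_neg.sub_const (k : ℂ)
  refine ((h.mul h1).div_const ((k : ℂ) + 1)).congr_deriv ?_
  ring

/-- The logarithmic derivative at `-N` is `-∑_{j<k} 1/(N-j)`, a difference of harmonic numbers. -/
theorem hasDerivAt_negBinom_of_le {N k : ℕ} (h : k ≤ N) :
    HasDerivAt (fun t => negBinom t k) (-(N.choose k : ℂ) * (harm N - harm (N - k)))
      (-(N : ℂ)) := by
  induction k with
  | zero => simpa [negBinom_zero] using hasDerivAt_const (-(N : ℂ)) (1 : ℂ)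
  | succ k ih =>
    refine (hasDerivAt_negBinom_succ (ih (by omega))).congr_deriv ?_
    obtain ⟨i, rfl⟩ := Nat.exists_eq_add_of_le h
    have h2 : ((k : ℂ) + 1) ≠ 0 := by exact_mod_cast k.succ_ne_zero
    have h5 : ((i : ℂ) + 1) ≠ 0 := by exact_mod_cast i.succ_ne_zero
    have h3 : (((k + 1 + i).choose (k + 1) : ℕ) : ℂ) * (k + 1)
        = (k + 1 + i).choose k * (i + 1) := by
      have := Nat.choose_succ_right_eq (k + 1 + i) k
      have h4 : k + 1 + i - k = i + 1 := by omega
      rw [h4] at this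
      exact_mod_cast this
    have h6 : (((k + 1 + i).choose (k + 1) : ℕ) : ℂ)
        = (k + 1 + i).choose k * (i + 1) / (k + 1) := by
      rw [← h3, mul_div_cancel_right₀ _ h2]
    have e1 : k + 1 + i - k = i + 1 := by omega
    have e2 : k + 1 + i - (k + 1) = i := by omega
    rw [negBinom_neg_nat (by omega), h6, e1, e2, harm_succ i]
    push_cast
    field_simp
    ring

/-- The factor `j = N` has a simple zero with derivative `-1`; the factors before it multiply to
`N!` and those after it to `(-1)^i i!`. -/
theorem hasDerivAt_negBinom_of_lt (N i : ℕ) :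
    HasDerivAt (fun t => negBinom t (N + 1 + i))
      (-(-1) ^ i * (N.factorial * i.factorial / (N + 1 + i).factorial : ℂ)) (-(N : ℂ)) := by
  induction i with
  | zero =>
    refine (hasDerivAt_negBinom_succ (hasDerivAt_negBinom_of_le le_rfl)).congr_deriv ?_
    have h1 : (N.factorial : ℂ) ≠ 0 := by exact_mod_cast N.factorial_ne_zero
    have h2 : ((N : ℂ) + 1) ≠ 0 := by exact_mod_cast N.succ_ne_zero
    rw [negBinom_neg_nat le_rfl, Nat.choose_self, add_zero, Nat.factorial_succ]
    push_cast
    field_simp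
    simp
  | succ i ih =>
    refine (hasDerivAt_negBinom_succ ih).congr_deriv ?_
    have h1 : ((N + 1 + i).factorial : ℂ) ≠ 0 := by exact_mod_cast Nat.factorial_ne_zero _
    have h2 : ((N : ℂ) + 1 + i + 1) ≠ 0 := by exact_mod_cast (N + 1 + i).succ_ne_zero
    rw [negBinom_neg_eq_zero (by omega), ← add_assoc, Nat.factorial_succ, Nat.factorial_succ]
    push_cast
    field_simp
    ring

theorem leadCoeff_succ_eq_mul (a : ℕ) (t : ℂ) :
    leadCoeff (a + 1) t = leadCoeff a t * ((a + 1) / (t - (a + 2))) := by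
  have e : t - (((a + 1 : ℕ) : ℂ) + 1) = t - (a + 2) := by push_cast; ring
  rw [leadCoeff, leadCoeff, Finset.prod_range_succ, e, Nat.factorial_succ, div_mul_div_comm]
  push_cast
  ring

theorem leadCoeff_neg_nat (a N : ℕ) : leadCoeff a (-(N : ℂ)) =
    (-1) ^ (a + 1) * (a.factorial * N.factorial / (N + a + 1).factorial) := by
  have h1 : (N.factorial : ℂ) ≠ 0 := by exact_mod_cast N.factorial_ne_zero
  induction a with
  | zero =>
    have h2 : ((N : ℂ) + 1) ≠ 0 := by exact_mod_cast N.succ_ne_zero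
    have h3 : (-(N : ℂ) - 1) ≠ 0 := by
      rw [← neg_ne_zero]; convert h2 using 1; ring
    rw [leadCoeff, add_zero, Nat.factorial_succ]
    simp
    field_simp
    ring
  | succ a ih =>
    have h2 : ((N : ℂ) + a + 2) ≠ 0 := by exact_mod_cast (N + a + 1).succ_ne_zero
    have h3 : (-(N : ℂ) - (a + 2)) ≠ 0 := by
      rw [← neg_ne_zero]; convert h2 using 1; ring
    have h4 : ((N + a + 1).factorial : ℂ) ≠ 0 := by exact_mod_cast Nat.factorial_ne_zero _
    have h5 : ((N : ℂ) + a + 1 + 1) ≠ 0 := by exact_mod_cast (N + a + 1).succ_ne_zero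
    rw [leadCoeff_succ_eq_mul, ih, ← add_assoc, Nat.factorial_succ (N + a + 1),
      Nat.factorial_succ a]
    push_cast
    field_simp
    ring

theorem neg_nat_ne_add_one (N j : ℕ) : -(N : ℂ) ≠ j + 1 := by
  intro h
  have : (N : ℂ) + j + 1 = 0 := by linear_combination -h
  exact (N + j).succ_ne_zero (by exact_mod_cast this)

/-- The logarithmic derivative at `-N` is `∑_{j≤a} 1/(N+j+1)`. -/
theorem hasDerivAt_leadCoeff (a N : ℕ) : HasDerivAt (leadCoeff a)
    (leadCoeff a (-(N : ℂ)) * (harm (N + a + 1) - harm N)) (-(N : ℂ)) := by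
  have hq : ∀ (c m : ℂ), -(N : ℂ) - m ≠ 0 → HasDerivAt (fun t : ℂ => c / (t - m))
      (-c / (-(N : ℂ) - m) ^ 2) (-(N : ℂ)) := by
    intro c m h
    refine ((hasDerivAt_const (-(N : ℂ)) c).fun_div
      ((hasDerivAt_id (-(N : ℂ))).sub_const m) h).congr_deriv ?_
    simp
  induction a with
  | zero =>
    have h3 : (-(N : ℂ) - 1) ≠ 0 := sub_ne_zero.2 (by simpa using neg_nat_ne_add_one N 0)
    have h2 : ((N : ℂ) + 1) ≠ 0 := by exact_mod_cast N.succ_ne_zero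
    have e : ∀ t, leadCoeff 0 t = 1 / (t - 1) := fun t => by simp [leadCoeff]
    rw [funext e, add_zero, harm_succ]
    refine (hq 1 1 h3).congr_deriv ?_
    field_simp
    ring
  | succ a ih =>
    have h3 : (-(N : ℂ) - (a + 2)) ≠ 0 := sub_ne_zero.2 (by
      have := neg_nat_ne_add_one N (a + 1)
      push_cast at this
      rwa [add_assoc, one_add_one_eq_two] at this)
    have h2 : ((N : ℂ) + a + 1 + 1) ≠ 0 := by exact_mod_cast (N + a + 1).succ_ne_zero
    rw [funext (leadCoeff_succ_eq_mul a), ← add_assoc, harm_succ (N + a + 1)]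
    refine (ih.mul (hq (a + 1) (a + 2) h3)).congr_deriv ?_
    push_cast
    field_simp
    ring

/-- The factor of the zeta function in the leading term of `mainPart`. -/
noncomputable def leadFactor (x : ℝ) (a : ℕ) (t : ℂ) : ℂ := leadCoeff a t * (x : ℂ) ^ (a + 1 - t)

/-- The factor of the zeta function in the `k`-th term of the sum in `mainPart`. -/
noncomputable def sumFactor (x : ℝ) (a k : ℕ) (t : ℂ) : ℂ :=
  negBinom t k * riemannZeta (-a - k) * (x : ℂ) ^ (-t - k)

theorem hasDerivAt_const_sub_cpow {x : ℝ} (hx : 0 < x) {f : ℂ → ℂ} {t : ℂ}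
    (hf : HasDerivAt f (-1) t) :
    HasDerivAt (fun t => (x : ℂ) ^ f t) (-((x : ℂ) ^ f t * (Real.log x : ℂ))) t := by
  have hx0 : (x : ℂ) ≠ 0 := by exact_mod_cast hx.ne'
  refine (hf.const_cpow (c := (x : ℂ)) (Or.inl hx0)).congr_deriv ?_
  rw [Complex.ofReal_log hx.le]
  ring

theorem leadFactor_neg_nat (x : ℝ) (a N : ℕ) : leadFactor x a (-(N : ℂ)) =
    (-1) ^ (a + 1) * (a.factorial * N.factorial / (N + a + 1).factorial) *
      (x : ℂ) ^ (N + a + 1) := by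
  have e : (a : ℂ) + 1 - -(N : ℂ) = ((N + a + 1 : ℕ) : ℂ) := by push_cast; ring
  rw [leadFactor, leadCoeff_neg_nat, e, Complex.cpow_natCast]

theorem hasDerivAt_leadFactor {x : ℝ} (hx : 0 < x) (a N : ℕ) : HasDerivAt (leadFactor x a)
    (leadFactor x a (-(N : ℂ)) * (harm (N + a + 1) - harm N - (Real.log x : ℂ))) (-(N : ℂ)) := by
  have h := (hasDerivAt_leadCoeff a N).mul (hasDerivAt_const_sub_cpow hx
    (f := fun t => (a : ℂ) + 1 - t) ((hasDerivAt_id (-(N : ℂ))).const_sub ((a : ℂ) + 1)))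
  refine h.congr_deriv ?_
  simp only [leadFactor]
  ring

theorem hasDerivAt_sumFactor {x : ℝ} (hx : 0 < x) (a k : ℕ) {t d : ℂ}
    (h : HasDerivAt (fun t => negBinom t k) d t) : HasDerivAt (sumFactor x a k)
      ((d - negBinom t k * (Real.log x : ℂ)) * riemannZeta (-a - k) * (x : ℂ) ^ (-t - k)) t := by
  have h2 := (h.mul_const (riemannZeta (-a - k))).mul (hasDerivAt_const_sub_cpow hx
    (f := fun t => -t - (k : ℂ)) ((hasDerivAt_id t).fun_neg.sub_const (k : ℂ)))
  refine h2.congr_deriv ?_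
  ring

theorem cpow_neg_neg_sub (x : ℝ) (N k : ℕ) :
    (x : ℂ) ^ (-(-(N : ℂ)) - k) = (x : ℂ) ^ ((N : ℤ) - k) := by
  rw [← Complex.cpow_intCast]
  push_cast
  rw [neg_neg]

theorem sumFactor_of_le (x : ℝ) (a : ℕ) {N k : ℕ} (h : k ≤ N) : sumFactor x a k (-(N : ℂ)) =
    N.choose k * riemannZeta (-a - k) * (x : ℂ) ^ ((N : ℤ) - k) := by
  rw [sumFactor, negBinom_neg_nat h, cpow_neg_neg_sub]

theorem sumFactor_of_lt (x : ℝ) (a : ℕ) {N k : ℕ} (h : N < k) :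
    sumFactor x a k (-(N : ℂ)) = 0 := by
  rw [sumFactor, negBinom_neg_eq_zero h, zero_mul, zero_mul]

theorem deriv_sumFactor_of_le {x : ℝ} (hx : 0 < x) (a : ℕ) {N k : ℕ} (h : k ≤ N) :
    deriv (sumFactor x a k) (-(N : ℂ)) = N.choose k * (harm (N - k) - harm N - (Real.log x : ℂ)) *
      riemannZeta (-a - k) * (x : ℂ) ^ ((N : ℤ) - k) := by
  rw [(hasDerivAt_sumFactor hx a k (hasDerivAt_negBinom_of_le h)).deriv, negBinom_neg_nat h,
    cpow_neg_neg_sub]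
  ring

theorem deriv_sumFactor_of_lt {x : ℝ} (hx : 0 < x) (a N i : ℕ) :
    deriv (sumFactor x a (N + 1 + i)) (-(N : ℂ)) =
      -(-1) ^ i * (N.factorial * i.factorial / (N + 1 + i).factorial) *
      riemannZeta (-a - (N + 1 + i : ℕ)) * (x : ℂ) ^ (-(i : ℤ) - 1) := by
  rw [(hasDerivAt_sumFactor hx a _ (hasDerivAt_negBinom_of_lt N i)).deriv,
    negBinom_neg_eq_zero (by omega), cpow_neg_neg_sub]
  have e : (N : ℤ) - (N + 1 + i : ℕ) = -(i : ℤ) - 1 := by push_cast; ring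
  rw [e]
  ring

theorem analyticAt_leadFactor {x : ℝ} (hx : 0 < x) (a N : ℕ) :
    AnalyticAt ℂ (leadFactor x a) (-(N : ℂ)) := by
  have h1 : AnalyticAt ℂ (leadCoeff a) (-(N : ℂ)) := by
    unfold leadCoeff
    have : Differentiable ℂ fun t : ℂ => ∏ j ∈ Finset.range (a + 1), (t - ((j : ℂ) + 1)) := by
      fun_prop
    exact analyticAt_const.div (this.analyticAt _)
      (leadCoeff_denom_ne_zero a fun j _ => neg_nat_ne_add_one N j)
  exact h1.mul ((differentiable_ofReal_cpow hx (f := fun t : ℂ => a + 1 - t)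
    (by fun_prop)).analyticAt _)

theorem analyticAt_sumFactor {x : ℝ} (hx : 0 < x) (a k : ℕ) (t : ℂ) :
    AnalyticAt ℂ (sumFactor x a k) t :=
  (((differentiable_negBinom k).mul_const _).mul
    (differentiable_ofReal_cpow hx (f := fun t : ℂ => -t - k) (by fun_prop))).analyticAt t

/-! ### Laurent expansion of `Theta` at `-N` -/

/-- The residue at `t₀` of `g t * ζ (u + t - t₀)`, where `g` has value `c` at `t₀`. -/
noncomputable def zetaRes (u c : ℂ) : ℂ := if u = 1 then c else 0

/-- The constant term at `t₀` of `g t * ζ (u + t - t₀)`, where `g` has value `c` and derivative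
`d` at `t₀`. -/
noncomputable def zetaConst (u c d : ℂ) : ℂ :=
  if u = 1 then d + (Real.eulerMascheroniConstant : ℂ) * c else c * riemannZeta u

theorem eventually_laurentAt_Theta {x : ℝ} (hx : 0 < x) (a N : ℕ) (s : ℂ) :
    ∀ᶠ K : ℕ in atTop, LaurentAt (fun t => Theta (-(a : ℂ)) s t x) (-(N : ℂ))
      (zetaRes (s - (N + a + 1)) (leadFactor x a (-(N : ℂ))) +
        ∑ k ∈ Finset.range K, zetaRes (s - N + k) (sumFactor x a k (-(N : ℂ))))
      (zetaConst (s - (N + a + 1)) (leadFactor x a (-(N : ℂ))) (deriv (leadFactor x a) (-(N : ℂ))) +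
        ∑ k ∈ Finset.range K, zetaConst (s - N + k) (sumFactor x a k (-(N : ℂ)))
          (deriv (sumFactor x a k) (-(N : ℂ)))) := by
  filter_upwards [eventually_exists_Theta_eventuallyEq hx a s (-(N : ℂ)), eventually_gt_atTop N]
    with K ⟨E, hE, hv, hT⟩ hK
  have h1 := LaurentAt.mul_riemannZeta (analyticAt_leadFactor hx a N) (s - (N + a + 1))
  have h2 := LaurentAt.sum (Finset.range K) fun k =>
    LaurentAt.mul_riemannZeta (analyticAt_sumFactor hx a k (-(N : ℂ))) (s - N + k)
  have h3 := (h1.add h2).add (LaurentAt.of_analyticAt hE)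
  -- The remainder contributes nothing, since `E (-N) = 0` once `K > N`.
  rw [hv N hK, add_zero, add_zero] at h3
  refine h3.congr (hT.trans (Eventually.of_forall fun t => ?_))
  simp only [mainPart]
  congr 1
  congr 1
  · rw [leadFactor]
    congr 2
    ring
  · refine Finset.sum_congr rfl fun k _ => ?_
    rw [sumFactor]
    congr 2
    ring

theorem zetaRes_zero (u : ℂ) : zetaRes u 0 = 0 := by simp [zetaRes]

theorem zetaRes_of_ne {u : ℂ} (hu : u ≠ 1) (c : ℂ) : zetaRes u c = 0 := if_neg hu

theorem zetaConst_of_ne {u : ℂ} (hu : u ≠ 1) (c d : ℂ) : zetaConst u c d = c * riemannZeta u :=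
  if_neg hu

theorem zetaRes_one (c : ℂ) : zetaRes 1 c = c := if_pos rfl

theorem zetaConst_one (c d : ℂ) :
    zetaConst 1 c d = d + (Real.eulerMascheroniConstant : ℂ) * c := if_pos rfl

theorem sum_range_eq_sum_range_of_lt {f : ℕ → ℂ} {M K : ℕ} (hMK : M ≤ K)
    (h : ∀ k, M ≤ k → f k = 0) : ∑ k ∈ Finset.range K, f k = ∑ k ∈ Finset.range M, f k := by
  refine (Finset.sum_subset (Finset.range_mono hMK) fun k _ hk => h k ?_).symm
  simpa using hk

/-- Covers Cases 1 and 2: a pole can come only from the leading term, and the sum stops at `N`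
because the binomials vanish beyond. -/
theorem laurentAt_Theta_of_sum_regular {x : ℝ} (hx : 0 < x) (a N : ℕ) {s : ℂ}
    (hs : ∀ k : ℕ, s - N + k ≠ 1) :
    LaurentAt (fun t => Theta (-(a : ℂ)) s t x) (-(N : ℂ))
      (zetaRes (s - (N + a + 1)) (leadFactor x a (-(N : ℂ))))
      (zetaConst (s - (N + a + 1)) (leadFactor x a (-(N : ℂ))) (deriv (leadFactor x a) (-(N : ℂ))) +
        ∑ k ∈ Finset.range (N + 1), N.choose k * riemannZeta (-a - k) * (x : ℂ) ^ ((N : ℤ) - k) *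
          riemannZeta (s - N + k)) := by
  obtain ⟨K, hK, hNK⟩ :=
    ((eventually_laurentAt_Theta hx a N s).and (eventually_ge_atTop (N + 1))).exists
  rw [Finset.sum_eq_zero fun k _ => zetaRes_of_ne (hs k) _, add_zero,
    sum_range_eq_sum_range_of_lt hNK] at hK
  · convert hK using 2
    refine Finset.sum_congr rfl fun k hk => ?_
    rw [zetaConst_of_ne (hs k), sumFactor_of_le x a (Nat.lt_succ_iff.1 (Finset.mem_range.1 hk))]
  · intro k hk
    rw [zetaConst_of_ne (hs k), sumFactor_of_lt x a (by omega), zero_mul]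

/-- Case 3: the zeta pole sits at `k = N + 1 + i`, where the coefficient vanishes; only the
derivative of that coefficient remains. -/
theorem laurentAt_Theta_nonpos {x : ℝ} (hx : 0 < x) (a N i : ℕ) :
    LaurentAt (fun t => Theta (-(a : ℂ)) (-(i : ℂ)) t x) (-(N : ℂ)) 0
      (leadFactor x a (-(N : ℂ)) * riemannZeta (-(i : ℂ) - (N + a + 1)) +
        ∑ k ∈ Finset.range (N + 1), N.choose k * riemannZeta (-a - k) * (x : ℂ) ^ ((N : ℤ) - k) *
          riemannZeta (-(i : ℂ) - N + k) +
        -(-1) ^ i * (N.factorial * i.factorial / (N + 1 + i).factorial) *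
          riemannZeta (-a - (N + 1 + i : ℕ)) * (x : ℂ) ^ (-(i : ℤ) - 1)) := by
  have hlead : -(i : ℂ) - (N + a + 1) ≠ 1 := fun h => by
    have : (i : ℂ) + N + a + 1 + 1 = 0 := by linear_combination -h
    exact (i + N + a + 1).succ_ne_zero (by exact_mod_cast this)
  have hone : ∀ k : ℕ, -(i : ℂ) - N + k = 1 ↔ k = N + 1 + i := fun k => by
    constructor
    · intro h
      have : (k : ℂ) = ((N + 1 + i : ℕ) : ℂ) := by push_cast; linear_combination h
      exact_mod_cast this
    · rintro rfl
      push_cast; ring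
  obtain ⟨K, hK, hNK⟩ :=
    ((eventually_laurentAt_Theta hx a N (-(i : ℂ))).and (eventually_ge_atTop (N + 1 + i + 1))).exists
  rw [zetaRes_of_ne hlead, zetaConst_of_ne hlead, zero_add, Finset.sum_eq_zero,
    ← Finset.sum_range_add_sum_Ico _ (by omega : N + 1 ≤ K),
    Finset.sum_eq_single_of_mem (N + 1 + i) (Finset.mem_Ico.2 (by omega)), (hone _).2 rfl,
    zetaConst_one, sumFactor_of_lt x a (by omega), mul_zero, add_zero,
    deriv_sumFactor_of_lt hx, ← add_assoc] at hK
  · convert hK using 3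
    refine Finset.sum_congr rfl fun k hk => ?_
    have hk' := Finset.mem_range.1 hk
    rw [zetaConst_of_ne (fun h => by have := (hone k).1 h; omega), sumFactor_of_le x a (by omega)]
  · intro k hk hki
    have hk' := Finset.mem_Ico.1 hk
    rw [zetaConst_of_ne (fun h => hki ((hone k).1 h)), sumFactor_of_lt x a (by omega), zero_mul]
  · intro k _
    by_cases h : k = N + 1 + i
    · rw [sumFactor_of_lt x a (by omega), zetaRes_zero]
    · exact zetaRes_of_ne (fun h' => h ((hone k).1 h')) _

/-- Case 4, with `s = N + 1 - j`: the zeta pole sits at `k = j ≤ N`, where the binomial is nonzero,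
so that term is isolated. -/
theorem laurentAt_Theta_pos {x : ℝ} (hx : 0 < x) (a N j : ℕ) (hj : j ≤ N) :
    LaurentAt (fun t => Theta (-(a : ℂ)) ((N : ℂ) + 1 - j) t x) (-(N : ℂ))
      (N.choose j * riemannZeta (-a - j) * (x : ℂ) ^ ((N : ℤ) - j))
      (leadFactor x a (-(N : ℂ)) * riemannZeta (-a - j) +
        ((∑ k ∈ (Finset.range (N + 1)).filter (fun k => k ≠ j), N.choose k * riemannZeta (-a - k) *
          (x : ℂ) ^ ((N : ℤ) - k) * riemannZeta (1 - j + k)) +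
        N.choose j * ((Real.eulerMascheroniConstant : ℂ) + harm (N - j) - harm N
          - (Real.log x : ℂ)) * riemannZeta (-a - j) * (x : ℂ) ^ ((N : ℤ) - j))) := by
  have hu : ∀ k : ℕ, (N : ℂ) + 1 - j - N + k = 1 - j + k := fun k => by ring
  have hul : (N : ℂ) + 1 - j - (N + a + 1) = -a - j := by ring
  have hlead : -(a : ℂ) - j ≠ 1 := fun h => by
    have : (a : ℂ) + j + 1 = 0 := by linear_combination -h
    exact (a + j).succ_ne_zero (by exact_mod_cast this)
  have hone : ∀ k : ℕ, 1 - (j : ℂ) + k = 1 ↔ k = j := fun k => by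
    constructor
    · intro h
      have : (k : ℂ) = j := by linear_combination h
      exact_mod_cast this
    · rintro rfl
      ring
  obtain ⟨K, hK, hNK⟩ :=
    ((eventually_laurentAt_Theta hx a N ((N : ℂ) + 1 - j)).and
      (eventually_ge_atTop (N + 1))).exists
  simp only [hu, hul] at hK
  rw [zetaRes_of_ne hlead, zetaConst_of_ne hlead, zero_add,
    Finset.sum_eq_single_of_mem j (Finset.mem_range.2 (by omega)), (hone j).2 rfl, zetaRes_one,
    sum_range_eq_sum_range_of_lt hNK,
    ← Finset.sum_filter_add_sum_filter_not (Finset.range (N + 1)) (fun k => k ≠ j),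
    sumFactor_of_le x a hj] at hK
  · convert hK using 3
    · refine Finset.sum_congr rfl fun k hk => ?_
      obtain ⟨hk1, hk2⟩ := Finset.mem_filter.1 hk
      have hk' := Finset.mem_range.1 hk1
      rw [zetaConst_of_ne (fun h => hk2 ((hone k).1 h)), sumFactor_of_le x a (by omega)]
    · have e : (Finset.range (N + 1)).filter (fun k => ¬ k ≠ j) = {j} := by
        ext k
        simp only [ne_eq, not_not, Finset.mem_filter, Finset.mem_range, Finset.mem_singleton]
        omega
      rw [e, Finset.sum_singleton, (hone j).2 rfl, zetaConst_one, sumFactor_of_le x a hj,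
        deriv_sumFactor_of_le hx a hj]
      ring
  · intro k hk
    rw [zetaConst_of_ne (fun h => by have := (hone k).1 h; omega), sumFactor_of_lt x a (by omega),
      zero_mul]
  · intro k _ hkj
    exact zetaRes_of_ne (fun h => hkj ((hone k).1 h)) _

/-! ### Translation to the integer parameters -/

theorem fac_natCast (n : ℕ) : fac (n : ℤ) = (n.factorial : ℂ) := by simp [fac]

theorem H_natCast (n : ℕ) : H (n : ℤ) = harm n := by simp [H, harm]

theorem meromorphicNFAt_Theta {x : ℝ} (hx : 0 < x) (a : ℕ) (s t : ℂ) :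
    MeromorphicNFAt (fun t => Theta (-(a : ℂ)) s t x) t :=
  (isContinuation_Theta hx a s).meromorphic (mem_univ t)

theorem fac_of_eq {n : ℤ} {m : ℕ} (h : n = m) : fac n = (m.factorial : ℂ) := by
  rw [h, fac_natCast]

theorem H_of_eq {n : ℤ} {m : ℕ} (h : n = m) : H n = harm m := by
  rw [h, H_natCast]

theorem factorial_div_zpow_mul {x : ℝ} {N k : ℕ} (hk : k ≤ N) {e : ℤ}
    (he : e = -((N : ℤ) - k)) (Z : ℂ) :
    (N.factorial : ℂ) * Z / ((x : ℂ) ^ e * k.factorial * (N - k).factorial) =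
      N.choose k * Z * (x : ℂ) ^ ((N : ℤ) - k) := by
  rw [he, zpow_neg, Nat.cast_choose ℂ hk, div_eq_mul_inv, mul_inv, mul_inv, inv_inv,
    div_eq_mul_inv, mul_inv]
  ring

theorem neg_one_zpow_sub_one (a : ℕ) : (-1 : ℂ) ^ (-(a : ℤ) - 1) = (-1) ^ (a + 1) := by
  have e : -(a : ℤ) - 1 = -((a + 1 : ℕ) : ℤ) := by push_cast; ring
  rw [e, zpow_neg, zpow_natCast, ← inv_pow]
  norm_num

theorem neg_one_zpow_neg (a : ℕ) : (-1 : ℂ) ^ (-(a : ℤ)) = (-1) ^ a := by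
  rw [zpow_neg, zpow_natCast, ← inv_pow]
  norm_num

end MordellTornheim
open MordellTornheim in
theorem theorem1 (r : ℤ) (hr : r ≤ 0) (ℓ : ℕ) (hℓ : 1 - r ≤ (ℓ : ℤ)) (x : ℝ) (hx : 0 < x) :
    -- the meromorphic continuation in `t` exists, and `Theta` is this continuation
    (∀ s : ℂ, IsContinuation (r : ℂ) s x (fun t => Theta (r : ℂ) s t x)) ∧
    -- Case 1
    (∀ s : ℂ,
      ((∀ n : ℤ, s ≠ (n : ℂ)) ∨ (∃ n : ℤ, s = (n : ℂ) ∧ r + ℓ < n ∧ n ≠ ℓ + 1)) →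
      AnalyticAt ℂ (fun t => Theta (r : ℂ) s t x) (1 - r - ℓ : ℂ) ∧
      (fun t : ℂ => Theta (r : ℂ) s t x -
        ((-1 : ℂ) ^ (r - 1) * (fac (r + ℓ - 1) / fac ℓ) * (x : ℂ) ^ ℓ * fac (-r) *
            riemannZeta (s - ℓ)
          + ∑ k ∈ Finset.range (r + ℓ).toNat,
              fac (r + ℓ - 1) * riemannZeta ((r : ℂ) - k) /
                ((x : ℂ) ^ (1 - r - ℓ + k : ℤ) * fac k * fac (r + ℓ - k - 1)) *
                riemannZeta (-(r : ℂ) + s - ℓ + k + 1)))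
        =O[𝓝 (1 - r - ℓ : ℂ)] (fun t : ℂ => t - (1 - r - ℓ : ℂ))) ∧
    -- Case 2: `s = ℓ + 1`
    ((fun t : ℂ => Theta (r : ℂ) ((ℓ : ℂ) + 1) t x -
        ((-1 : ℂ) ^ (r - 1) * fac (-r) * (x : ℂ) ^ ℓ *
            (fac (r + ℓ - 1) / (fac ℓ * (t - (1 - r - ℓ : ℂ))))
          + (-1 : ℂ) ^ (r - 1) * fac (-r) * (x : ℂ) ^ ℓ * (fac (r + ℓ - 1) / fac ℓ) *
            ((Real.eulerMascheroniConstant : ℂ) - (Real.log x : ℂ) + H ℓ - H (r + ℓ - 1))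
          + ∑ k ∈ Finset.range (r + ℓ).toNat,
              (((r + ℓ - 1).toNat.choose k : ℕ) : ℂ) *
                (riemannZeta ((r : ℂ) - k) / (x : ℂ) ^ (k - r - ℓ + 1 : ℤ)) *
                riemannZeta ((k : ℂ) - r + 2)))
        =O[𝓝[≠] (1 - r - ℓ : ℂ)] (fun t : ℂ => t - (1 - r - ℓ : ℂ))) ∧
    -- Case 3: `s ≤ r + ℓ` a non-positive integer
    (∀ s : ℤ, s ≤ 0 → s ≤ r + ℓ →
      AnalyticAt ℂ (fun t => Theta (r : ℂ) (s : ℂ) t x) (1 - r - ℓ : ℂ) ∧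
      (fun t : ℂ => Theta (r : ℂ) (s : ℂ) t x -
        ((-1 : ℂ) ^ (r - 1) * (x : ℂ) ^ ℓ * (fac (-r) * fac (r + ℓ - 1) / fac ℓ) *
            riemannZeta ((s : ℂ) - ℓ)
          + ∑ k ∈ Finset.range (r + ℓ).toNat,
              riemannZeta ((r : ℂ) - k) * fac (r + ℓ - 1) /
                ((x : ℂ) ^ (k - r - ℓ + 1 : ℤ) * fac k * fac (r + ℓ - k - 1)) *
                riemannZeta ((s : ℂ) + 1 - r - ℓ + k)
          + (-1 : ℂ) ^ (s - 1) * (x : ℂ) ^ (s - 1) *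
            (fac (r + ℓ - 1) * fac (-s) / fac (r + ℓ - s)) * riemannZeta ((s : ℂ) - ℓ)))
        =O[𝓝 (1 - r - ℓ : ℂ)] (fun t : ℂ => t - (1 - r - ℓ : ℂ))) ∧
    -- Case 4: `s ≤ r + ℓ` a positive integer
    (∀ s : ℤ, 1 ≤ s → s ≤ r + ℓ →
      (fun t : ℂ => Theta (r : ℂ) (s : ℂ) t x -
        ((x : ℂ) ^ (s - 1) * (fac (r + ℓ - 1) / (fac (r + ℓ - s) * fac (s - 1))) *
            (riemannZeta ((s : ℂ) - ℓ) / (t - (1 - r - ℓ : ℂ)))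
          + (x : ℂ) ^ (s - 1) * (fac (r + ℓ - 1) / (fac (r + ℓ - s) * fac (s - 1))) *
            ((Real.eulerMascheroniConstant : ℂ) - H (r + ℓ - 1) + H (s - 1)
              - (Real.log x : ℂ)) * riemannZeta ((s : ℂ) - ℓ)
          - (-1 : ℂ) ^ r * (x : ℂ) ^ ℓ * (fac (-r) * fac (r + ℓ - 1) / fac ℓ) *
            riemannZeta ((s : ℂ) - ℓ)
          + ∑ k ∈ (Finset.range (r + ℓ).toNat).filter (fun k : ℕ => (k : ℤ) ≠ r + ℓ - s),
              fac (r + ℓ - 1) * riemannZeta ((r : ℂ) - k) /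
                (fac (r + ℓ - k - 1) * (x : ℂ) ^ (k - r - ℓ + 1 : ℤ) * fac k) *
                riemannZeta ((s : ℂ) - r - ℓ + k + 1)))
        =O[𝓝[≠] (1 - r - ℓ : ℂ)] (fun t : ℂ => t - (1 - r - ℓ : ℂ))) := by

  obtain ⟨a, rfl⟩ : ∃ a : ℕ, r = -(a : ℤ) := ⟨(-r).toNat, by omega⟩
  -- `N = r + ℓ - 1` is nonnegative by `hℓ`, and `t₀ = -N`.
  obtain ⟨N, rfl⟩ : ∃ N : ℕ, ℓ = N + a + 1 := ⟨ℓ - (a + 1), by omega⟩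
  have hrc : ((-(a : ℤ) : ℤ) : ℂ) = -(a : ℂ) := by push_cast; ring
  have ht0 : 1 - -(a : ℂ) - ((N + a + 1 : ℕ) : ℂ) = -(N : ℂ) := by push_cast; ring
  have hlc : ((N + a + 1 : ℕ) : ℂ) = N + a + 1 := by push_cast; ring
  have hN : fac (-(a : ℤ) + ((N + a + 1 : ℕ) : ℤ) - 1) = N.factorial :=
    fac_of_eq (by push_cast; ring)
  have ha : fac (- -(a : ℤ)) = a.factorial := fac_of_eq (by ring)
  have hrange : (-(a : ℤ) + ((N + a + 1 : ℕ) : ℤ)).toNat = N + 1 := by omega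
  have hNk : ∀ k ≤ N, fac (-(a : ℤ) + ((N + a + 1 : ℕ) : ℤ) - k - 1) = (N - k).factorial :=
    fun k hk => fac_of_eq (by push_cast [hk]; ring)
  have hHN : H (-(a : ℤ) + ((N + a + 1 : ℕ) : ℤ) - 1) = harm N := H_of_eq (by push_cast; ring)
  simp only [hrc, ht0, hN, ha, hrange, hHN, fac_natCast, H_natCast, neg_one_zpow_sub_one,
    neg_one_zpow_neg]
  refine ⟨isContinuation_Theta hx a, fun s hs => ?_, ?_, fun s hs _ => ?_, fun s hs1 hs2 => ?_⟩
  · have hreg : (∀ k : ℕ, s - N + k ≠ 1) ∧ s - (N + a + 1) ≠ 1 := by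
      rcases hs with hs | ⟨n, rfl, h1, h2⟩
      · refine ⟨fun k hk => hs (N + 1 - k) ?_, fun h => hs (N + a + 2) ?_⟩
        · push_cast; linear_combination hk
        · push_cast; linear_combination h
      · refine ⟨fun k hk => ?_, fun h => ?_⟩
        · have : n - N + k = 1 := by exact_mod_cast hk
          omega
        · have : n - (N + a + 1) = 1 := by exact_mod_cast h
          omega
    have hL := laurentAt_Theta_of_sum_regular hx a N hreg.1
    rw [zetaRes_of_ne hreg.2, zetaConst_of_ne hreg.2] at hL
    refine cast ?_ (hL.analyticAt_and_isBigO (meromorphicNFAt_Theta hx a s _))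
    congr 3
    funext t
    congr 2
    · rw [leadFactor_neg_nat, hlc]
      ring
    · refine Finset.sum_congr rfl fun k hk => ?_
      have hk' : k ≤ N := Nat.lt_succ_iff.1 (Finset.mem_range.1 hk)
      rw [hNk k hk', factorial_div_zpow_mul hk' (by push_cast; ring)]
      congr 2
      push_cast; ring
  · have hu : ((N + a + 1 : ℕ) : ℂ) + 1 - (N + a + 1) = 1 := by push_cast; ring
    have hreg : ∀ k : ℕ, ((N + a + 1 : ℕ) : ℂ) + 1 - N + k ≠ 1 := fun k hk => by
      have : (a : ℂ) + k + 1 = 0 := by push_cast at hk; linear_combination hk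
      exact (a + k).succ_ne_zero (by exact_mod_cast this)
    have hL := laurentAt_Theta_of_sum_regular hx a N hreg
    rw [hu, zetaRes_one, zetaConst_one, (hasDerivAt_leadFactor hx a N).deriv] at hL
    refine hL.isBigO.congr_left fun t => ?_
    congr 1
    rw [← add_assoc]
    congr 1
    · rw [leadFactor_neg_nat, div_mul_eq_div_div]
      ring
    · refine Finset.sum_congr rfl fun k hk => ?_
      have hk' : k ≤ N := Nat.lt_succ_iff.1 (Finset.mem_range.1 hk)
      have e1 : ((k : ℤ) - -(a : ℤ) - ((N + a + 1 : ℕ) : ℤ) + 1) = -((N : ℤ) - k) := by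
        push_cast; ring
      have e2 : (-(a : ℤ) + ((N + a + 1 : ℕ) : ℤ) - 1).toNat = N := by omega
      have e3 : ((N + a + 1 : ℕ) : ℂ) + 1 - N + k = k - -(a : ℂ) + 2 := by push_cast; ring
      rw [e1, e2, e3, zpow_neg, div_inv_eq_mul, mul_assoc _ (riemannZeta _)]
  · obtain ⟨i, rfl⟩ : ∃ i : ℕ, s = -(i : ℤ) := ⟨(-s).toNat, by omega⟩
    have hsc : ((-(i : ℤ) : ℤ) : ℂ) = -(i : ℂ) := by push_cast; ring
    have hi : fac (- -(i : ℤ)) = i.factorial := fac_of_eq (by ring)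
    have hi2 : fac (-(a : ℤ) + ((N + a + 1 : ℕ) : ℤ) - -(i : ℤ)) = (N + 1 + i).factorial :=
      fac_of_eq (by push_cast; ring)
    simp only [hsc, hi, hi2, neg_one_zpow_sub_one]
    refine cast ?_ ((laurentAt_Theta_nonpos hx a N i).analyticAt_and_isBigO
      (meromorphicNFAt_Theta hx a _ _))
    congr 3
    funext t
    congr 2
    · congr 1
      · rw [leadFactor_neg_nat, hlc]
        ring
      · refine Finset.sum_congr rfl fun k hk => ?_
        have hk' : k ≤ N := Nat.lt_succ_iff.1 (Finset.mem_range.1 hk)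
        rw [hNk k hk', mul_comm (riemannZeta _) (N.factorial : ℂ),
          factorial_div_zpow_mul hk' (by push_cast; ring)]
        congr 2
        push_cast; ring
    · have e : -(i : ℂ) - ((N + a + 1 : ℕ) : ℂ) = -(a : ℂ) - ((N + 1 + i : ℕ) : ℂ) := by
        push_cast; ring
      rw [e, pow_succ]
      ring
  · obtain ⟨j, hj⟩ : ∃ j : ℕ, s = N + 1 - j := ⟨(N + 1 - s).toNat, by omega⟩
    subst hj
    have hjN : j ≤ N := by omega
    have hsc : (((N : ℤ) + 1 - j : ℤ) : ℂ) = (N : ℂ) + 1 - j := by push_cast; ring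
    have hj1 : fac ((N : ℤ) - j) = (N - j).factorial :=
      fac_of_eq (by push_cast [hjN]; rfl)
    have hj2 : fac (-(a : ℤ) + ((N + a + 1 : ℕ) : ℤ) - ((N : ℤ) + 1 - j)) = j.factorial :=
      fac_of_eq (by push_cast; ring)
    have hj3 : H ((N : ℤ) - j) = harm (N - j) := H_of_eq (by push_cast [hjN]; rfl)
    have hz : (N : ℂ) + 1 - j - ((N + a + 1 : ℕ) : ℂ) = -a - j := by push_cast; ring
    have hx1 : (N : ℤ) + 1 - j - 1 = N - j := by ring
    have hfil : ∀ k : ℕ, ((k : ℤ) ≠ -(a : ℤ) + ((N + a + 1 : ℕ) : ℤ) - ((N : ℤ) + 1 - j)) ↔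
        k ≠ j := fun k => by
      push_cast; omega
    simp only [hsc, hj1, hj2, hj3, hz, hfil, hx1]
    refine (laurentAt_Theta_pos hx a N j hjN).isBigO.congr_left fun t => ?_
    have hsum : ∑ k ∈ (Finset.range (N + 1)).filter (fun k => k ≠ j),
          N.choose k * riemannZeta (-a - k) * (x : ℂ) ^ ((N : ℤ) - k) * riemannZeta (1 - j + k)
        = ∑ k ∈ (Finset.range (N + 1)).filter (fun k => k ≠ j),
          (N.factorial : ℂ) * riemannZeta (-(a : ℂ) - k) /
            (fac (-(a : ℤ) + ((N + a + 1 : ℕ) : ℤ) - k - 1) *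
              (x : ℂ) ^ ((k : ℤ) - -(a : ℤ) - ((N + a + 1 : ℕ) : ℤ) + 1) * fac k) *
            riemannZeta ((N : ℂ) + 1 - j - -(a : ℂ) - ((N + a + 1 : ℕ) : ℂ) + k + 1) := by
      refine Finset.sum_congr rfl fun k hk => ?_
      have hk' : k ≤ N := Nat.lt_succ_iff.1 (Finset.mem_range.1 (Finset.mem_filter.1 hk).1)
      have e : (N : ℂ) + 1 - j - -(a : ℂ) - ((N + a + 1 : ℕ) : ℂ) + k + 1 = 1 - j + k := by
        push_cast; ring
      rw [hNk k hk', e, fac_natCast, mul_comm ((N - k).factorial : ℂ), mul_right_comm _ _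
        (k.factorial : ℂ), factorial_div_zpow_mul hk' (by push_cast; ring)]
    simp only [fac_natCast] at hsum
    rw [← hsum, leadFactor_neg_nat, Nat.cast_choose ℂ hjN]
    ring
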